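/- Let $k$ be a field of characteristic zero and let $r\geq 0$ be a real number. Assume that $k$ is a $C_r$ field, that is, every homogeneous polynomial of degree $d>0$ over $k$ in more than $d^r$ variables has a nontrivial zero over $k$. Let $X=Q_1\cap\dots\cap Q_c\subset\mathbb{P}^N_k$ be a smooth complete intersection of $c$ quadrics over $k$ of positive dimension, that is, the scheme-theoretic intersection of the quadrics is smooth over $k$ of pure dimension $N-c\geq 1$. If $$N-c^2+2>2^r c,$$ then $X$ is rational over $k$, that is, birational over $k$ to $\mathbb{P}^{N-c}_k$. -/

import Mathlib

open CategoryTheory AlgebraicGeometry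

universe u

section QuotientGrading

variable {R A : Type*} [CommRing R] [CommRing A] [Algebra R A]
  {𝒜 : ℕ → Submodule R A} [GradedAlgebra 𝒜]

/-- The grading on the quotient `A ⧸ I` of a graded algebra by a homogeneous ideal:
the degree `n` part is the image of `𝒜 n`. -/
def quotientGrading (I : HomogeneousIdeal 𝒜) (n : ℕ) : Submodule R (A ⧸ I.toIdeal) :=
  (𝒜 n).map (Ideal.Quotient.mkₐ R I.toIdeal).toLinearMap

theorem mk_mem_quotientGrading (I : HomogeneousIdeal 𝒜) {n : ℕ} {a : A} (ha : a ∈ 𝒜 n) :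
    Ideal.Quotient.mk I.toIdeal a ∈ quotientGrading I n :=
  ⟨a, ha, rfl⟩

instance quotientGrading_gradedMonoid (I : HomogeneousIdeal 𝒜) :
    SetLike.GradedMonoid (quotientGrading I) where
  one_mem := ⟨1, SetLike.GradedOne.one_mem, rfl⟩
  mul_mem := by
    rintro i j _ _ ⟨a, ha, rfl⟩ ⟨b, hb, rfl⟩
    exact ⟨a * b, SetLike.GradedMul.mul_mem ha hb, rfl⟩

/-- The degree `n` part of the quotient map. -/
def quotientGradingMap (I : HomogeneousIdeal 𝒜) (n : ℕ) : 𝒜 n →ₗ[R] quotientGrading I n :=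
  ((Ideal.Quotient.mkₐ R I.toIdeal).toLinearMap.restrict
    (p := 𝒜 n) (q := quotientGrading I n) fun _ ha => mk_mem_quotientGrading I ha)

/-- The decomposition of `A ⧸ I` into its homogeneous components, induced by that of `A`. -/
noncomputable def quotientDecompose (I : HomogeneousIdeal 𝒜) :
    A ⧸ I.toIdeal →+ DirectSum ℕ fun n => quotientGrading I n :=
  QuotientAddGroup.lift I.toIdeal.toAddSubgroup
    ((DirectSum.map fun n => (quotientGradingMap I n).toAddMonoidHom).comp
      (DirectSum.decomposeAddEquiv 𝒜).toAddMonoidHom) (by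
    intro a ha
    ext n
    have h := I.isHomogeneous n (show a ∈ I.toIdeal from ha)
    exact Ideal.Quotient.eq_zero_iff_mem.mpr h)

theorem quotientDecompose_mk (I : HomogeneousIdeal 𝒜) (a : A) :
    quotientDecompose I (Ideal.Quotient.mk I.toIdeal a) =
      DirectSum.map (fun n => (quotientGradingMap I n).toAddMonoidHom)
        (DirectSum.decompose 𝒜 a) :=
  rfl

noncomputable instance quotientGrading_gradedRing (I : HomogeneousIdeal 𝒜) :
    GradedRing (quotientGrading I) where
  decompose' := quotientDecompose I
  left_inv := by
    intro x
    obtain ⟨a, rfl⟩ := Ideal.Quotient.mk_surjective x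
    rw [quotientDecompose_mk]
    induction a using DirectSum.Decomposition.inductionOn 𝒜 with
    | zero => simp
    | homogeneous m =>
      rw [DirectSum.decompose_coe, DirectSum.map_of, DirectSum.coeAddMonoidHom_of]
      rfl
    | add a b ha hb => rw [DirectSum.decompose_add, map_add, map_add, ha, hb, map_add]
  right_inv := by
    intro x
    induction x using DirectSum.induction_on with
    | zero => simp
    | of i y =>
      obtain ⟨_, a, ha, rfl⟩ := y
      rw [DirectSum.coeAddMonoidHom_of]
      change quotientDecompose I (Ideal.Quotient.mk I.toIdeal a) = _
      rw [quotientDecompose_mk, DirectSum.decompose_of_mem 𝒜 ha, DirectSum.map_of]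
      rfl
    | add x y hx hy => rw [map_add, map_add, hx, hy]

end QuotientGrading

section Schemes

attribute [local instance] MvPolynomial.gradedAlgebra

/-- The structure morphism `Proj 𝒜 ⟶ Spec k` of the `Proj` of a graded `k`-algebra. -/
noncomputable def projStructureMap {k A : Type u} [CommRing k] [CommRing A] [Algebra k A]
    (𝒜 : ℕ → Submodule k A) [GradedAlgebra 𝒜] : Proj 𝒜 ⟶ Spec (.of k) :=
  Proj.toSpecZero 𝒜 ≫ Spec.map (CommRingCat.ofHom (algebraMap k (𝒜 0)))

/-- Projective space `ℙⁿ` over `k`. -/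
noncomputable abbrev projectiveSpace (k : Type u) [Field k] (n : ℕ) : Scheme.{u} :=
  Proj (MvPolynomial.homogeneousSubmodule (Fin (n + 1)) k)

/-- The structure morphism `ℙⁿ ⟶ Spec k`. -/
noncomputable abbrev projectiveSpaceToSpec (k : Type u) [Field k] (n : ℕ) :
    projectiveSpace k n ⟶ Spec (.of k) :=
  projStructureMap (MvPolynomial.homogeneousSubmodule (Fin (n + 1)) k)

variable {k : Type u} [Field k] {N c d : ℕ}

/-- The homogeneous ideal generated by forms `F₁, …, F_c` of degree `d`. -/
noncomputable def formsIdeal (F : Fin c → MvPolynomial (Fin (N + 1)) k) (hF : ∀ i, (F i).IsHomogeneous d) :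
    HomogeneousIdeal (MvPolynomial.homogeneousSubmodule (Fin (N + 1)) k) :=
  ⟨Ideal.span (Set.range F), Ideal.homogeneous_span _ _ (by
    rintro _ ⟨i, rfl⟩
    exact ⟨d, hF i⟩)⟩

/-- The scheme-theoretic intersection in `ℙᴺ` of the hypersurfaces `F₁ = 0, …, F_c = 0`,
that is `Proj k[x₀, …, x_N] ⧸ (F₁, …, F_c)`. -/
noncomputable abbrev intersectionScheme (F : Fin c → MvPolynomial (Fin (N + 1)) k)
    (hF : ∀ i, (F i).IsHomogeneous d) : Scheme.{u} :=
  Proj (quotientGrading (formsIdeal F hF))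

/-- The structure morphism to `Spec k` of the intersection of hypersurfaces. -/
noncomputable abbrev intersectionToSpec (F : Fin c → MvPolynomial (Fin (N + 1)) k)
    (hF : ∀ i, (F i).IsHomogeneous d) : intersectionScheme F hF ⟶ Spec (.of k) :=
  projStructureMap (quotientGrading (formsIdeal F hF))

/-- The intersection in `ℙᴺ` of `c ≤ N` hypersurfaces `F₁ = 0, …, F_c = 0` is a smooth complete
intersection: it has (pure) codimension `c`, i.e. dimension `N - c`, and is smooth over `k`. -/
def IsSmoothCompleteIntersection (F : Fin c → MvPolynomial (Fin (N + 1)) k)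
    (hF : ∀ i, (F i).IsHomogeneous d) : Prop :=
  c ≤ N ∧ SmoothOfRelativeDimension (N - c) (intersectionToSpec F hF)

end Schemes

/-- `k` is a `C_r` field, for a real number `r`: every form of degree `d > 0` in more than `d ^ r`
variables has a nontrivial zero. -/
def IsCr (r : ℝ) (k : Type*) [Field k] : Prop :=
  ∀ (n d : ℕ) (f : MvPolynomial (Fin (n + 1)) k), 0 < d → f.IsHomogeneous d →
    (d : ℝ) ^ r < (n : ℝ) + 1 → ∃ x : Fin (n + 1) → k, x ≠ 0 ∧ MvPolynomial.eval x f = 0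

/-! # Rationality of intersections of quadrics over `C_r` fields

Over a `C_r` field, `c` quadratic forms in more than `2 ^ r * c` variables have a common nontrivial
zero (`IsCr.exists_common_zero`, the theorem of Lang and Nagata): if `k` is not algebraically closed,
substitution into norm forms of large degree reduces to the case of one form. Applied `c` times,
each time inside the common orthogonal complement of the vectors found so far, this gives a linear
subspace `Λ` of dimension `c - 1` contained in `X`
(`exists_linearIndependent_isotropic`); the inequality on `N` is what the last step needs.

In coordinates `(y, z)` with `Λ = {z = 0}`, the equations of `X` are linear in `y`, of the form
`L(z) y + q(z) = 0` with a square matrix `L` of linear forms and a vector `q` of quadratic forms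
(`AdaptedCoordinates`). Geometrically, a general linear space of dimension `c` containing `Λ`
meets `X` outside `Λ` in one point. Hence the projection `(y, z) ↦ z` has the rational inverse
`z ↦ (-adj(L) q, det(L) z)`, by Cramer's rule, and is an isomorphism over the open set
`det(L) z₀ ≠ 0` (`AdaptedCoordinates.gradedProjection_map_bijective`).

It remains to see that this open set is nonempty, that is `det L ≠ 0`, and dense in `X`; both use
smoothness.

* The Jacobian criterion (`IsSmoothCompleteIntersection.exists_sum_pderiv_eq`) says that the
  equations are submersive at each solution over each extension field; it is applied to first order
  deformations, written in dual numbers. A polynomial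
  vector in the kernel of `L` would, where it does not vanish, make `L` surjective
  (`AdaptedCoordinates.aeval_det_ne_zero_of_ker`), so `det L ≠ 0`.
* The local rings of `X` are domains (`AlgebraicGeometry.Smooth.isDomain_stalk`), so each point has a
  generic generization, which does not change along specializations. All points of `X` are then
  connected by specializations (`AdaptedCoordinates.exists_forall_specializes`): those with
  `det L(z) ≠ 0` lie in the closure of the image of the parametrization, each of the others lies on a
  line in `X` meeting `Λ`, and the closure of the image of the parametrization meets `Λ`. Therefore
  `X` is irreducible.

Points of `X` are handled as solutions of the equations in domains (`solutionPoint`,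
`exists_eq_solutionPoint`), specializations between them as homomorphisms of domains.
-/

/-! ### Systems of forms over an algebraically closed field -/

/-- The homomorphism `k[x₁, …, xₙ] → k[x₁, …, xₙ]` killing the first `j` variables. -/
noncomputable def killVariables (k : Type*) [Field k] (n j : ℕ) :
    MvPolynomial (Fin n) k →ₐ[k] MvPolynomial (Fin n) k :=
  MvPolynomial.aeval fun i => if (i : ℕ) < j then 0 else MvPolynomial.X i

/-- The ideals `(x₁, …, x_j)` form a strictly increasing chain of primes. -/
theorem le_height_ker_killVariables (k : Type*) [Field k] (n j : ℕ) (hj : j ≤ n) :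
    (j : ℕ∞) ≤ (RingHom.ker (killVariables k n j)).height := by
  induction j with
  | zero => simp
  | succ j ih =>
    have hprime (i : ℕ) : (RingHom.ker (killVariables k n i)).IsPrime := RingHom.ker_isPrime _
    have := hprime j
    have := hprime (j + 1)
    have hlt : RingHom.ker (killVariables k n j) < RingHom.ker (killVariables k n (j + 1)) := by
      have hcomp : (killVariables k n (j + 1)).comp (killVariables k n j) =
          killVariables k n (j + 1) := by
        apply MvPolynomial.algHom_ext
        intro i
        by_cases h : (i : ℕ) < j
        · simp [killVariables, h, h.le]
        · simp [killVariables, h]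
      refine lt_of_le_of_ne ?_ ?_
      · intro f hf
        rw [RingHom.mem_ker] at hf ⊢
        rw [← hcomp, AlgHom.comp_apply, hf, map_zero]
      · intro h
        have h1 : (MvPolynomial.X ⟨j, hj⟩ : MvPolynomial (Fin n) k) ∈
            RingHom.ker (killVariables k n (j + 1)) := by
          simp [RingHom.mem_ker, killVariables]
        rw [← h, RingHom.mem_ker] at h1
        simp [killVariables] at h1
    calc ((j + 1 : ℕ) : ℕ∞) = (j : ℕ∞) + 1 := by push_cast; rfl
      _ ≤ (RingHom.ker (killVariables k n j)).height + 1 := by gcongr; exact ih (by omega)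
      _ ≤ _ := Ideal.height_add_one_le_of_lt_of_isPrime hlt

/-- Over an algebraically closed field, fewer than `n` forms of positive degree in `n` variables
have a common nontrivial zero: otherwise the origin would have codimension less than `n`, by
Krull's height theorem. -/
theorem exists_common_zero_of_isAlgClosed {k : Type*} [Field k] [IsAlgClosed k] {n c d : ℕ}
    (f : Fin c → MvPolynomial (Fin n) k) (hd : 0 < d) (hf : ∀ i, (f i).IsHomogeneous d)
    (hc : c < n) : ∃ x : Fin n → k, x ≠ 0 ∧ ∀ i, MvPolynomial.eval x (f i) = 0 := by
  by_contra! hcon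
  set I : Ideal (MvPolynomial (Fin n) k) := Ideal.span (Set.range f)
  set m := RingHom.ker (killVariables k n n)
  have hm : m = MvPolynomial.vanishingIdeal k ({0} : Set (Fin n → k)) := by
    ext g
    rw [MvPolynomial.mem_vanishingIdeal_singleton_iff]
    have : killVariables k n n g = MvPolynomial.C (MvPolynomial.aeval (0 : Fin n → k) g) := by
      have h : killVariables k n n = (Algebra.ofId k _).comp (MvPolynomial.aeval (0 : Fin n → k)) := by
        apply MvPolynomial.algHom_ext
        intro i
        simp [killVariables]
      rw [h]; rfl
    rw [RingHom.mem_ker, this]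
    simp
  have hzero : MvPolynomial.zeroLocus k I = {0} := by
    rw [MvPolynomial.zeroLocus_span]
    ext x
    constructor
    · intro hx
      by_contra h0
      obtain ⟨i, hi⟩ := hcon x h0
      exact hi (hx _ ⟨i, rfl⟩)
    · rintro rfl _ ⟨i, rfl⟩
      rw [MvPolynomial.aeval_zero, MvPolynomial.constantCoeff_eq, (hf i).coeff_eq_zero]
      · simp
      · simp; omega
  have hrad : I.radical = m := by
    rw [hm, ← hzero, MvPolynomial.vanishingIdeal_zeroLocus_eq_radical]
  have hprime : m.IsPrime := RingHom.ker_isPrime _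
  have hmin : m ∈ I.minimalPrimes := by
    refine ⟨⟨hprime, ?_⟩, ?_⟩
    · rw [← hrad]; exact Ideal.le_radical
    · rintro p ⟨hp, hIp⟩ -
      rw [← hrad]
      exact hp.radical_le_iff.mpr hIp
  have h1 := Ideal.height_le_card_of_mem_minimalPrimes_span (Set.finite_range f) hmin
  have h2 := le_height_ker_killVariables k n n le_rfl
  have h3 : (n : ℕ∞) ≤ (Set.range f).ncard := h2.trans h1
  have h4 : (Set.range f).ncard ≤ c := by
    rw [← Set.image_univ]
    refine (Set.ncard_image_le Set.finite_univ).trans ?_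
    simp
  have h5 : n ≤ (Set.range f).ncard := by exact_mod_cast h3
  omega

/-! ### Systems of forms over a `C_r` field -/

/-- There is a form of degree `d` in `m` variables over `k` whose only zero over `k` is the trivial
one. -/
def HasAnisotropicForm (k : Type*) [Field k] (d m : ℕ) : Prop :=
  ∃ f : MvPolynomial (Fin m) k, f.IsHomogeneous d ∧
    ∀ x : Fin m → k, MvPolynomial.eval x f = 0 → x = 0

/-- Substituting disjoint copies of an anisotropic system of `c` forms of degree `d` in `n`
variables into an anisotropic form of degree `D` in `M` variables, `c` variables at a time, the
remaining variables being set to zero. -/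
theorem HasAnisotropicForm.substitute {k : Type*} [Field k] {D M d n c : ℕ}
    (h : HasAnisotropicForm k D M) (f : Fin c → MvPolynomial (Fin n) k)
    (hf : ∀ i, (f i).IsHomogeneous d)
    (hani : ∀ x : Fin n → k, (∀ i, MvPolynomial.eval x (f i) = 0) → x = 0) :
    HasAnisotropicForm k (d * D) (M / c * n) := by
  obtain ⟨Φ, hΦ, hΦani⟩ := h
  let g : Fin M → MvPolynomial (Fin (M / c * n)) k := fun j =>
    if hj : (j : ℕ) < M / c * c then
      MvPolynomial.rename
        (fun a => finProdFinEquiv ((finProdFinEquiv.symm (⟨j, hj⟩ : Fin (M / c * c))).1, a))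
        (f (finProdFinEquiv.symm (⟨j, hj⟩ : Fin (M / c * c))).2)
    else 0
  refine ⟨MvPolynomial.aeval g Φ, hΦ.aeval g fun j => ?_, fun x hx => ?_⟩
  · simp only [g]
    split_ifs
    · exact (hf _).rename_isHomogeneous
    · exact MvPolynomial.isHomogeneous_zero _ _ _
  · have h1 : (fun j => MvPolynomial.eval x (g j)) = 0 := by
      apply hΦani
      simp only [← MvPolynomial.coe_aeval_eq_eval, RingHom.coe_coe] at hx ⊢
      rw [← hx, MvPolynomial.comp_aeval_apply]
    have h2 (b : Fin (M / c)) : (fun a => x (finProdFinEquiv (b, a))) = 0 := by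
      apply hani
      intro i
      have hlt : ((finProdFinEquiv (b, i) : Fin (M / c * c)) : ℕ) < M :=
        (finProdFinEquiv (b, i)).2.trans_le (Nat.div_mul_le_self M c)
      have h3 := congrFun h1 ⟨_, hlt⟩
      simp only [g, Fin.is_lt, dite_true, Fin.eta, Equiv.symm_apply_apply,
        MvPolynomial.eval_rename, Pi.zero_apply] at h3
      exact h3
    funext p
    obtain ⟨⟨b, a⟩, rfl⟩ := finProdFinEquiv.surjective p
    exact congrFun (h2 b) a

theorem isHomogeneous_det {σ ι R : Type*} [CommRing R] [Fintype ι] [DecidableEq ι]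
    {d : ℕ} (A : Matrix ι ι (MvPolynomial σ R)) (hA : ∀ i j, (A i j).IsHomogeneous d) :
    A.det.IsHomogeneous (d * Fintype.card ι) := by
  rw [Matrix.det_apply]
  refine MvPolynomial.IsHomogeneous.sum _ _ _ fun s _ => ?_
  have h : (∏ i, A (s i) i).IsHomogeneous (∑ _i : ι, d) :=
    MvPolynomial.IsHomogeneous.prod _ _ _ fun i _ => hA _ _
  rw [Finset.sum_const, Finset.card_univ, smul_eq_mul, mul_comm] at h
  rcases Int.units_eq_one_or (Equiv.Perm.sign s) with hs | hs
  · simpa [hs] using h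
  · simpa [hs] using h.neg

/-- The norm form of a finite extension is anisotropic of degree equal to its number of variables. -/
theorem hasAnisotropicForm_finrank (k L : Type*) [Field k] [Field L] [Algebra k L]
    [FiniteDimensional k L] :
    HasAnisotropicForm k (Module.finrank k L) (Module.finrank k L) := by
  let b := Module.finBasis k L
  let A : Matrix (Fin (Module.finrank k L)) (Fin (Module.finrank k L))
      (MvPolynomial (Fin (Module.finrank k L)) k) := fun p q =>
    ∑ i, MvPolynomial.C (Algebra.leftMulMatrix b (b i) p q) * MvPolynomial.X i
  refine ⟨A.det, ?_, fun x hx => ?_⟩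
  · have := isHomogeneous_det (d := 1) A fun p q =>
      MvPolynomial.IsHomogeneous.sum _ _ _ fun i _ => MvPolynomial.isHomogeneous_C_mul_X _ _
    simpa using this
  · have h1 : (MvPolynomial.eval x).mapMatrix A = Algebra.leftMulMatrix b (∑ i, x i • b i) := by
      ext p q
      rw [RingHom.mapMatrix_apply, Matrix.map_apply]
      simp [A, Matrix.sum_apply, mul_comm]
    rw [RingHom.map_det, h1, ← Algebra.norm_eq_matrix_det, Algebra.norm_eq_zero_iff] at hx
    exact funext (Fintype.linearIndependent_iff.mp b.linearIndependent x hx)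

/-- Over a field which is not algebraically closed, there are anisotropic forms of arbitrarily large degree
in as many variables as their degree, by iterated substitution of a norm form into itself. -/
theorem exists_hasAnisotropicForm {k : Type*} [Field k] (hk : ¬ IsAlgClosed k) (B : ℝ) :
    ∃ e : ℕ, B < e ∧ 0 < e ∧ HasAnisotropicForm k e e := by
  obtain ⟨e, he, hani⟩ : ∃ e : ℕ, 2 ≤ e ∧ HasAnisotropicForm k e e := by
    by_contra! hcon
    apply hk
    apply IsAlgClosed.of_exists_root
    intro p hp hirr
    have := Fact.mk hirr
    have hfin : FiniteDimensional k (AdjoinRoot p) := hp.finite_adjoinRoot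
    have hfr : Module.finrank k (AdjoinRoot p) = p.natDegree := by
      rw [(AdjoinRoot.powerBasis hirr.ne_zero).finrank, AdjoinRoot.powerBasis_dim]
    have h1 : p.natDegree < 2 := by
      by_contra! h2
      have := hasAnisotropicForm_finrank k (AdjoinRoot p)
      rw [hfr] at this
      exact hcon _ h2 this
    have h2 : 0 < p.natDegree := hirr.natDegree_pos
    have h3 : p.degree = 1 := by
      rw [Polynomial.degree_eq_natDegree hirr.ne_zero]
      norm_cast
      omega
    exact Polynomial.exists_root_of_degree_eq_one h3
  have hpow (j : ℕ) : HasAnisotropicForm k (e ^ (j + 1)) (e ^ (j + 1)) := by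
    induction j with
    | zero => simpa using hani
    | succ j ih =>
      obtain ⟨f, hf, hfani⟩ := hani
      have := ih.substitute (c := 1) (fun _ => f) (fun _ => hf) fun x hx => hfani x (hx 0)
      rw [Nat.div_one, mul_comm e, ← pow_succ] at this
      exact this
  obtain ⟨j, hj⟩ := pow_unbounded_of_one_lt B (show (1 : ℝ) < e by exact_mod_cast he)
  refine ⟨e ^ (j + 1), ?_, by positivity, hpow j⟩
  push_cast
  refine hj.trans ?_
  apply pow_lt_pow_right₀ (by exact_mod_cast he) (Nat.lt_succ_self j)

/-- The defining property of `C_r` fields bounds the number of variables of anisotropic forms. -/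
theorem IsCr.le_of_hasAnisotropicForm {r : ℝ} {k : Type*} [Field k] (hk : IsCr r k) {D M : ℕ}
    (hD : 0 < D) (h : HasAnisotropicForm k D M) : (M : ℝ) ≤ (D : ℝ) ^ r := by
  obtain ⟨f, hf, hani⟩ := h
  cases M with
  | zero => simpa using Real.rpow_nonneg (Nat.cast_nonneg D) r
  | succ n =>
    by_contra! hlt
    obtain ⟨x, hx, hfx⟩ := hk n D f hD hf (by exact_mod_cast hlt)
    exact hx (hani x hfx)

/-- **Lang–Nagata**: over a `C_r` field, a system of `c` forms of degree `d` in more than `d ^ r * c`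
variables has a common nontrivial zero. Over a field which is not algebraically closed, an
anisotropic system could be substituted again and again into a norm form of large degree; the number
of variables would grow faster than the `r`-th power of the degree. -/
theorem IsCr.exists_common_zero {r : ℝ} (hr : 0 ≤ r) {k : Type*} [Field k] (hk : IsCr r k)
    {n c d : ℕ} (hd : 0 < d) (f : Fin c → MvPolynomial (Fin n) k) (hf : ∀ i, (f i).IsHomogeneous d)
    (hn : (d : ℝ) ^ r * c < n) :
    ∃ x : Fin n → k, x ≠ 0 ∧ ∀ i, MvPolynomial.eval x (f i) = 0 := by
  have hd1 : (1 : ℝ) ≤ (d : ℝ) ^ r := Real.one_le_rpow (by exact_mod_cast hd) hr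
  have hcn : (c : ℝ) < n := lt_of_le_of_lt (le_mul_of_one_le_left (Nat.cast_nonneg c) hd1) hn
  by_cases hac : IsAlgClosed k
  · exact exists_common_zero_of_isAlgClosed f hd hf (by exact_mod_cast hcn)
  by_contra! hcon
  have hani : ∀ x : Fin n → k, (∀ i, MvPolynomial.eval x (f i) = 0) → x = 0 := by
    intro x hx
    by_contra h0
    obtain ⟨i, hi⟩ := hcon x h0
    exact hi (hx i)
  have hc : 0 < c := by
    rcases Nat.eq_zero_or_pos c with rfl | hc
    · have h1 := hani 1 (fun i => i.elim0)
      have hn0 : 0 < n := by simpa using hn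
      have := congrFun h1 ⟨0, hn0⟩
      simp at this
    · exact hc
  have hc' : (0 : ℝ) < c := by exact_mod_cast hc
  set ρ : ℝ := n / c with hρ
  have hρd : (d : ℝ) ^ r < ρ := by rw [hρ, lt_div_iff₀ hc']; exact hn
  have hρ1 : 1 < ρ := lt_of_le_of_lt hd1 hρd
  -- the fixed point of the recursion `M ↦ ρ * M - n`
  set B : ℝ := n / (ρ - 1) with hB
  have hBfix : ρ * B - n = B := by
    have : ρ - 1 ≠ 0 := by linarith
    rw [hB]; field_simp; ring
  obtain ⟨e, heB, he0, he⟩ := exists_hasAnisotropicForm hac B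
  have hstep (j : ℕ) : ∃ M : ℕ, HasAnisotropicForm k (d ^ j * e) M ∧ ρ ^ j * (e - B) ≤ M - B := by
    induction j with
    | zero => exact ⟨e, by simpa using he, by simp⟩
    | succ j ih =>
      obtain ⟨M, hM, hle⟩ := ih
      refine ⟨M / c * n, ?_, ?_⟩
      · have := hM.substitute f hf hani
        rwa [← mul_assoc, ← pow_succ'] at this
      · have h1 : (M : ℝ) / c - 1 ≤ ((M / c : ℕ) : ℝ) := by
          have := Nat.lt_floor_add_one ((M : ℝ) / c)
          rw [Nat.floor_div_natCast, Nat.floor_natCast] at this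
          linarith
        have h2 : ρ * M - n ≤ ((M / c * n : ℕ) : ℝ) := by
          push_cast
          calc ρ * M - n = ((M : ℝ) / c - 1) * n := by rw [hρ]; ring
            _ ≤ _ := by gcongr
        calc ρ ^ (j + 1) * (e - B) = ρ * (ρ ^ j * (e - B)) := by ring
          _ ≤ ρ * (M - B) := by gcongr
          _ = (ρ * M - n) - (ρ * B - n) := by ring
          _ = (ρ * M - n) - B := by rw [hBfix]
          _ ≤ _ := by linarith
  have hBnonneg : 0 ≤ B := div_nonneg (Nat.cast_nonneg n) (by linarith)
  set δ : ℝ := (d : ℝ) ^ r with hδ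
  have hδ0 : 0 < δ := by linarith
  have hbound (j : ℕ) : (ρ / δ) ^ j * (e - B) ≤ (e : ℝ) ^ r := by
    obtain ⟨M, hM, hle⟩ := hstep j
    have h1 := hk.le_of_hasAnisotropicForm (by positivity) hM
    have h2 : ((d ^ j * e : ℕ) : ℝ) ^ r = δ ^ j * (e : ℝ) ^ r := by
      push_cast
      rw [Real.mul_rpow (by positivity) (by positivity), hδ, ← Real.rpow_natCast,
        ← Real.rpow_natCast, ← Real.rpow_mul (by positivity), ← Real.rpow_mul (by positivity),
        mul_comm r]
    rw [h2] at h1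
    rw [div_pow, div_mul_eq_mul_div, div_le_iff₀ (by positivity), mul_comm (_ ^ r)]
    linarith
  obtain ⟨j, hj⟩ := pow_unbounded_of_one_lt ((e : ℝ) ^ r / (e - B))
    (show 1 < ρ / δ by rwa [lt_div_iff₀ hδ0, one_mul])
  rw [div_lt_iff₀ (by linarith)] at hj
  exact absurd (hbound j) (not_le.mpr hj)

/-! ### Quadratic forms and isotropic subspaces -/

theorem MvPolynomial.IsHomogeneous.exists_isSymm_matrix {k : Type*} [Field k] [CharZero k] {m : ℕ}
    {F : MvPolynomial (Fin m) k} (hF : F.IsHomogeneous 2) :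
    ∃ M : Matrix (Fin m) (Fin m) k, M.IsSymm ∧
      F = ∑ p, ∑ q, MvPolynomial.C (M p q) * (MvPolynomial.X p * MvPolynomial.X q) := by
  obtain ⟨A, hA⟩ : ∃ A : Matrix (Fin m) (Fin m) k,
      2 * F = ∑ p, ∑ q, MvPolynomial.C (A p q) * (MvPolynomial.X p * MvPolynomial.X q) := by
    refine ⟨fun p q => MvPolynomial.coeff 0 (MvPolynomial.pderiv q (MvPolynomial.pderiv p F)), ?_⟩
    have h1 := hF.sum_X_mul_pderiv
    rw [nsmul_eq_mul] at h1
    rw [show (2 : MvPolynomial (Fin m) k) = ((2 : ℕ) : MvPolynomial (Fin m) k) by norm_cast, ← h1]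
    refine Finset.sum_congr rfl fun p _ => ?_
    have h2 : (MvPolynomial.pderiv p F).IsHomogeneous 1 := hF.pderiv
    have h3 := h2.sum_X_mul_pderiv
    rw [one_smul] at h3
    rw [← h3, Finset.mul_sum]
    refine Finset.sum_congr rfl fun q _ => ?_
    have h4 : (MvPolynomial.pderiv q (MvPolynomial.pderiv p F)).IsHomogeneous 0 := h2.pderiv
    rw [← MvPolynomial.totalDegree_zero_iff_isHomogeneous,
      MvPolynomial.totalDegree_eq_zero_iff_eq_C] at h4
    rw [← h4]
    ring
  refine ⟨(4⁻¹ : k) • (A + A.transpose), ?_, ?_⟩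
  · rw [Matrix.IsSymm, Matrix.transpose_smul, Matrix.transpose_add, Matrix.transpose_transpose,
      add_comm]
  · have hswap : ∑ p, ∑ q, MvPolynomial.C (A q p) * (MvPolynomial.X p * MvPolynomial.X q) =
        2 * F := by
      rw [hA, Finset.sum_comm]
      refine Finset.sum_congr rfl fun p _ => Finset.sum_congr rfl fun q _ => ?_
      ring
    have h4 : (MvPolynomial.C (4⁻¹ : k) : MvPolynomial (Fin m) k) * 4 = 1 := by
      rw [show (4 : MvPolynomial (Fin m) k) = MvPolynomial.C 4 from (map_ofNat _ 4).symm, ← map_mul,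
        inv_mul_cancel₀ (by norm_num), map_one]
    have hsum : ∑ p, ∑ q, MvPolynomial.C (((4⁻¹ : k) • (A + A.transpose)) p q) *
        (MvPolynomial.X p * MvPolynomial.X q) = MvPolynomial.C (4⁻¹ : k) * (2 * F + 2 * F) := by
      nth_rw 1 [hA]
      rw [← hswap]
      simp only [← Finset.sum_add_distrib, Finset.mul_sum]
      refine Finset.sum_congr rfl fun p _ => Finset.sum_congr rfl fun q _ => ?_
      simp only [Matrix.smul_apply, Matrix.add_apply, Matrix.transpose_apply, smul_eq_mul, map_mul,
        map_add]
      ring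
    rw [hsum]
    linear_combination (-F) * h4

theorem sum_smul_dotProduct_mulVec {R ι ι' : Type*} [CommRing R] [Fintype ι] [Fintype ι']
    (M : Matrix ι ι R) (x : ι' → R) (u : ι' → ι → R) :
    (∑ s, x s • u s) ⬝ᵥ M.mulVec (∑ s, x s • u s) =
      ∑ s, ∑ t, u s ⬝ᵥ M.mulVec (u t) * (x s * x t) := by
  rw [sum_dotProduct]
  refine Finset.sum_congr rfl fun s _ => ?_
  rw [Matrix.mulVec_sum, dotProduct_sum]
  refine Finset.sum_congr rfl fun t _ => ?_
  rw [Matrix.mulVec_smul, smul_dotProduct, dotProduct_smul, smul_eq_mul, smul_eq_mul]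
  ring

/-- Common isotropic subspaces of `c` quadratic forms over a `C_r` field can be built one vector at a
time: a new vector is sought among the vectors orthogonal to the ones already found, in a complement
of their span. -/
theorem exists_linearIndependent_isotropic {r : ℝ} (hr : 0 ≤ r) {k : Type*} [Field k]
    (hk : IsCr r k) {m c : ℕ} (M : Fin c → Matrix (Fin m) (Fin m) k) (hM : ∀ i, (M i).IsSymm)
    (l : ℕ) (hl : (2 : ℝ) ^ r * c + (l - 1) * (c + 1) < m) :
    ∃ v : Fin l → Fin m → k, LinearIndependent k v ∧ ∀ i j j', v j ⬝ᵥ (M i).mulVec (v j') = 0 := by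
  induction l with
  | zero => exact ⟨fun j => j.elim0, linearIndependent_empty_type, fun _ j => j.elim0⟩
  | succ l ih =>
    obtain ⟨v, hv, hiso⟩ := ih (by push_cast at hl; nlinarith [Nat.cast_nonneg (α := ℝ) c])
    let ev : (Fin m → k) →ₗ[k] (Fin c × Fin l → k) :=
      LinearMap.pi fun p => Matrix.toLinearMap₂' k (M p.1) (v p.2)
    obtain ⟨C, hC⟩ := Submodule.exists_isCompl (Submodule.span k (Set.range v))
    let W : Submodule k (Fin m → k) := LinearMap.ker ev ⊓ C
    have hW : m ≤ Module.finrank k W + l * (c + 1) := by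
      have h1 := LinearMap.finrank_range_add_finrank_ker ev
      have h2 : Module.finrank k (LinearMap.range ev) ≤ c * l := by
        have := Submodule.finrank_le (LinearMap.range ev)
        simpa using this
      have h3 := Submodule.finrank_sup_add_finrank_inf_eq (LinearMap.ker ev) C
      have h4 := Submodule.finrank_le (LinearMap.ker ev ⊔ C)
      have h5 := Submodule.finrank_add_eq_of_isCompl hC
      rw [finrank_span_eq_card hv] at h5
      simp only [Module.finrank_fin_fun, Fintype.card_fin] at *
      change m ≤ Module.finrank k ↥(LinearMap.ker ev ⊓ C) + _
      nlinarith
    let b := Module.finBasis k W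
    let f : Fin c → MvPolynomial (Fin (Module.finrank k W)) k := fun i =>
      ∑ s, ∑ t, MvPolynomial.C ((b s : Fin m → k) ⬝ᵥ (M i).mulVec (b t)) *
        (MvPolynomial.X s * MvPolynomial.X t)
    have hf (i) : (f i).IsHomogeneous 2 := by
      refine MvPolynomial.IsHomogeneous.sum _ _ _ fun s _ =>
        MvPolynomial.IsHomogeneous.sum _ _ _ fun t _ => ?_
      exact MvPolynomial.IsHomogeneous.C_mul
        ((MvPolynomial.isHomogeneous_X _ _).mul (MvPolynomial.isHomogeneous_X _ _)) _
    obtain ⟨x, hx, hfx⟩ := hk.exists_common_zero hr two_pos f hf (by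
      have h1 : (m : ℝ) ≤ Module.finrank k W + l * (c + 1) := by exact_mod_cast hW
      push_cast at hl ⊢
      linarith)
    obtain ⟨w, hw⟩ : ∃ w : W, w = ∑ s, x s • b s := ⟨_, rfl⟩
    have hw0 : w ≠ 0 := fun h =>
      hx (funext (Fintype.linearIndependent_iff.mp b.linearIndependent x (hw.symm.trans h)))
    have hwM (i) : (w : Fin m → k) ⬝ᵥ (M i).mulVec w = 0 := by
      have hw' : (w : Fin m → k) = ∑ s, x s • (b s : Fin m → k) := by rw [hw]; simp
      rw [← hfx i, hw', sum_smul_dotProduct_mulVec]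
      simp [f]
    have hwv (i j) : v j ⬝ᵥ (M i).mulVec w = 0 := by
      have := congrFun (LinearMap.mem_ker.mp w.2.1) (i, j)
      simpa [ev, Matrix.toLinearMap₂'_apply'] using this
    refine ⟨Fin.cons w v, linearIndependent_finCons.mpr ⟨hv, fun hmem => ?_⟩, fun i => ?_⟩
    · have := hC.disjoint.le_bot ⟨hmem, w.2.2⟩
      exact hw0 (Subtype.ext this)
    · intro j j'
      refine Fin.cases ?_ (fun j => ?_) j <;> refine Fin.cases ?_ (fun j' => ?_) j'
      · exact hwM i
      · simp only [Fin.cons_zero, Fin.cons_succ]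
        rw [Matrix.dotProduct_mulVec, ← Matrix.mulVec_transpose, (hM i), dotProduct_comm]
        exact hwv i j'
      · exact hwv i j
      · exact hiso i j j'

/-! ### Adapted coordinates -/

/-- Linear coordinates `(y, z)` on `k ^ (N + 1)` adapted to a common isotropic subspace `z = 0` of
dimension `c` of the quadratic forms `F₁, …, F_c`: in these coordinates `F = L(z) y + q(z)`, with a
square matrix `L` of linear forms and a vector `q` of quadratic forms. -/
structure AdaptedCoordinates {k : Type*} [Field k] {N c : ℕ} (F : Fin c → MvPolynomial (Fin (N + 1)) k)
    (n : ℕ) where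
  /-- The matrix of the basis vectors. -/
  basis : Matrix (Fin (N + 1)) (Fin c ⊕ Fin (n + 1)) k
  /-- The matrix of the coordinate functions. -/
  coord : Matrix (Fin c ⊕ Fin (n + 1)) (Fin (N + 1)) k
  basis_mul_coord : basis * coord = 1
  coord_mul_basis : coord * basis = 1
  /-- The linear coefficients of the forms in the coordinates `y`. -/
  L : Matrix (Fin c) (Fin c) (MvPolynomial (Fin (n + 1)) k)
  /-- The parts of the forms not involving the coordinates `y`. -/
  q : Fin c → MvPolynomial (Fin (n + 1)) k
  isHomogeneous_L : ∀ i j, (L i j).IsHomogeneous 1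
  isHomogeneous_q : ∀ i, (q i).IsHomogeneous 2
  aeval_eq : ∀ i, MvPolynomial.aeval (fun p => ∑ s, MvPolynomial.C (basis p s) * MvPolynomial.X s)
    (F i) = ∑ j, MvPolynomial.rename Sum.inr (L i j) * MvPolynomial.X (Sum.inl j) +
      MvPolynomial.rename Sum.inr (q i)

theorem exists_adaptedCoordinates {k : Type*} [Field k] {N c n : ℕ} (hn : n + c = N)
    (F : Fin c → MvPolynomial (Fin (N + 1)) k)
    (M : Fin c → Matrix (Fin (N + 1)) (Fin (N + 1)) k) (hM : ∀ i, (M i).IsSymm)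
    (hF : ∀ i, F i = ∑ p, ∑ q, MvPolynomial.C (M i p q) * (MvPolynomial.X p * MvPolynomial.X q))
    (v : Fin c → Fin (N + 1) → k) (hv : LinearIndependent k v)
    (hiso : ∀ i j j', v j ⬝ᵥ (M i).mulVec (v j') = 0) :
    Nonempty (AdaptedCoordinates F n) := by
  obtain ⟨C, hC⟩ := Submodule.exists_isCompl (Submodule.span k (Set.range v))
  have hfr : Module.finrank k C = n + 1 := by
    have h5 := Submodule.finrank_add_eq_of_isCompl hC
    rw [finrank_span_eq_card hv] at h5
    simp only [Module.finrank_fin_fun, Fintype.card_fin] at h5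
    omega
  let b := Module.finBasisOfFinrankEq k C hfr
  let w : Fin (n + 1) → Fin (N + 1) → k := fun a => b a
  have hw : LinearIndependent k w := b.linearIndependent.map' C.subtype C.ker_subtype
  have hspan : Submodule.span k (Set.range w) ≤ C := by
    rw [Submodule.span_le]
    rintro _ ⟨a, rfl⟩
    exact (b a).2
  have hu : LinearIndependent k (Sum.elim v w) := hv.sum_type hw (hC.disjoint.mono_right hspan)
  let u : Module.Basis (Fin c ⊕ Fin (n + 1)) k (Fin (N + 1) → k) :=
    basisOfLinearIndependentOfCardEqFinrank hu (by simp; omega)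
  have hu' (s) : u s = Sum.elim v w s := by simp [u]
  let P := (Pi.basisFun k (Fin (N + 1))).toMatrix u
  have hP (p s) : P p s = Sum.elim v w s p := by
    simp [P, Module.Basis.toMatrix_apply, hu']
  have hsym (i) (s t) : Sum.elim v w s ⬝ᵥ (M i).mulVec (Sum.elim v w t) =
      Sum.elim v w t ⬝ᵥ (M i).mulVec (Sum.elim v w s) := by
    rw [Matrix.dotProduct_mulVec, ← Matrix.mulVec_transpose, hM i, dotProduct_comm]
  refine ⟨{
    basis := P
    coord := u.toMatrix (Pi.basisFun k (Fin (N + 1)))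
    basis_mul_coord := Module.Basis.toMatrix_mul_toMatrix_flip _ _
    coord_mul_basis := Module.Basis.toMatrix_mul_toMatrix_flip _ _
    L := fun i j => ∑ a, MvPolynomial.C (2 * (v j ⬝ᵥ (M i).mulVec (w a))) * MvPolynomial.X a
    q := fun i => ∑ a, ∑ b, MvPolynomial.C (w a ⬝ᵥ (M i).mulVec (w b)) *
      (MvPolynomial.X a * MvPolynomial.X b)
    isHomogeneous_L := fun i j => MvPolynomial.IsHomogeneous.sum _ _ _ fun a _ =>
      MvPolynomial.isHomogeneous_C_mul_X _ _
    isHomogeneous_q := fun i => MvPolynomial.IsHomogeneous.sum _ _ _ fun a _ =>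
      MvPolynomial.IsHomogeneous.sum _ _ _ fun b _ => MvPolynomial.IsHomogeneous.C_mul
        ((MvPolynomial.isHomogeneous_X _ _).mul (MvPolynomial.isHomogeneous_X _ _)) _
    aeval_eq := fun i => ?_ }⟩
  have h1 : MvPolynomial.aeval (fun p => ∑ s, MvPolynomial.C (P p s) * MvPolynomial.X s) (F i) =
      ∑ s, ∑ t, MvPolynomial.C (Sum.elim v w s ⬝ᵥ (M i).mulVec (Sum.elim v w t)) *
        (MvPolynomial.X s * MvPolynomial.X t) := by
    have h2 := sum_smul_dotProduct_mulVec ((M i).map MvPolynomial.C) MvPolynomial.X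
      fun (s : Fin c ⊕ Fin (n + 1)) p => (MvPolynomial.C (P p s) : MvPolynomial (Fin c ⊕ Fin (n + 1)) k)
    have h3 : (∑ s, (MvPolynomial.X s : MvPolynomial (Fin c ⊕ Fin (n + 1)) k) • fun p => (MvPolynomial.C (P p s) :
        MvPolynomial (Fin c ⊕ Fin (n + 1)) k)) =
        fun p => ∑ s, MvPolynomial.C (P p s) * MvPolynomial.X s := by
      funext p
      simp [mul_comm]
    rw [h3] at h2
    have h4 (s t) : (fun p => (MvPolynomial.C (P p s) : MvPolynomial (Fin c ⊕ Fin (n + 1)) k)) ⬝ᵥ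
        ((M i).map MvPolynomial.C).mulVec (fun p => MvPolynomial.C (P p t)) =
        MvPolynomial.C (Sum.elim v w s ⬝ᵥ (M i).mulVec (Sum.elim v w t)) := by
      simp [dotProduct, Matrix.mulVec, hP]
    simp only [h4] at h2
    rw [← h2, hF i]
    simp only [map_sum, map_mul, MvPolynomial.aeval_X, MvPolynomial.aeval_C, dotProduct,
      Matrix.mulVec, Matrix.map_apply, Finset.mul_sum, MvPolynomial.algebraMap_eq]
    refine Finset.sum_congr rfl fun p _ => Finset.sum_congr rfl fun q _ => ?_
    simp only [← Finset.mul_sum]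
    ring
  rw [h1, Fintype.sum_sum_type]
  simp only [Fintype.sum_sum_type, Sum.elim_inl, Sum.elim_inr, hiso, map_zero, zero_mul,
    Finset.sum_const_zero, zero_add, Finset.sum_add_distrib, map_sum, map_mul, MvPolynomial.rename_X,
    MvPolynomial.rename_C]
  rw [← add_assoc]
  congr 1
  rw [Finset.sum_comm (s := (Finset.univ : Finset (Fin (n + 1))))
    (t := (Finset.univ : Finset (Fin c))), ← Finset.sum_add_distrib]
  refine Finset.sum_congr rfl fun j _ => ?_
  rw [Finset.sum_mul, ← Finset.sum_add_distrib]
  refine Finset.sum_congr rfl fun a _ => ?_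
  have h5 := hsym i (Sum.inl j) (Sum.inr a)
  simp only [Sum.elim_inl, Sum.elim_inr] at h5
  rw [← h5, map_ofNat]
  ring

namespace AdaptedCoordinates

variable {k : Type*} [Field k] {N c n : ℕ} {F : Fin c → MvPolynomial (Fin (N + 1)) k}
  (A : AdaptedCoordinates F n) {R R' : Type*} [CommRing R] [Algebra k R] [CommRing R'] [Algebra k R']

/-- The point with adapted coordinates `(y, z)`. -/
def point (y : Fin c → R) (z : Fin (n + 1) → R) : Fin (N + 1) → R :=
  (A.basis.map (algebraMap k R)).mulVec (Sum.elim y z)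

/-- The first adapted coordinates `y` of a point. -/
def yCoord (a : Fin (N + 1) → R) (j : Fin c) : R :=
  (A.coord.map (algebraMap k R)).mulVec a (Sum.inl j)

/-- The last adapted coordinates `z` of a point. -/
def zCoord (a : Fin (N + 1) → R) (m : Fin (n + 1)) : R :=
  (A.coord.map (algebraMap k R)).mulVec a (Sum.inr m)

theorem point_coord (a : Fin (N + 1) → R) : A.point (A.yCoord a) (A.zCoord a) = a := by
  have h1 : Sum.elim (A.yCoord a) (A.zCoord a) = (A.coord.map (algebraMap k R)).mulVec a := by
    funext s
    cases s <;> rfl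
  rw [point, h1, Matrix.mulVec_mulVec, ← Matrix.map_mul, A.basis_mul_coord,
    Matrix.map_one _ (map_zero _) (map_one _), Matrix.one_mulVec]

theorem coord_point (y : Fin c → R) (z : Fin (n + 1) → R) :
    (A.coord.map (algebraMap k R)).mulVec (A.point y z) = Sum.elim y z := by
  rw [point, Matrix.mulVec_mulVec, ← Matrix.map_mul, A.coord_mul_basis,
    Matrix.map_one _ (map_zero _) (map_one _), Matrix.one_mulVec]

theorem yCoord_point (y : Fin c → R) (z : Fin (n + 1) → R) : A.yCoord (A.point y z) = y :=
  funext fun j => congrFun (A.coord_point y z) (Sum.inl j)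

theorem zCoord_point (y : Fin c → R) (z : Fin (n + 1) → R) : A.zCoord (A.point y z) = z :=
  funext fun m => congrFun (A.coord_point y z) (Sum.inr m)

theorem point_smul (t : R) (y : Fin c → R) (z : Fin (n + 1) → R) :
    A.point (t • y) (t • z) = t • A.point y z := by
  have h : Sum.elim (t • y) (t • z) = t • Sum.elim y z := by
    funext s
    cases s <;> rfl
  rw [point, h, Matrix.mulVec_smul, point]

theorem map_point (φ : R →ₐ[k] R') (y : Fin c → R) (z : Fin (n + 1) → R) (p : Fin (N + 1)) :
    φ (A.point y z p) = A.point (fun j => φ (y j)) (fun m => φ (z m)) p := by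
  simp [point, Matrix.mulVec, dotProduct]

theorem map_zCoord (φ : R →ₐ[k] R') (a : Fin (N + 1) → R) (m : Fin (n + 1)) :
    φ (A.zCoord a m) = A.zCoord (fun p => φ (a p)) m := by
  simp [zCoord, Matrix.mulVec, dotProduct]

/-- The value of the forms in adapted coordinates. -/
theorem aeval_point (y : Fin c → R) (z : Fin (n + 1) → R) (i : Fin c) :
    MvPolynomial.aeval (A.point y z) (F i) =
      ∑ j, MvPolynomial.aeval z (A.L i j) * y j + MvPolynomial.aeval z (A.q i) := by
  have h := congrArg (MvPolynomial.aeval (R := k) (Sum.elim y z)) (A.aeval_eq i)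
  rw [MvPolynomial.comp_aeval_apply] at h
  simp only [map_add, map_sum, map_mul, MvPolynomial.aeval_X, MvPolynomial.aeval_C,
    MvPolynomial.aeval_rename, Sum.elim_inl, Sum.elim_comp_inr] at h
  rw [← h]
  rfl

end AdaptedCoordinates

/-! ### Local rings of smooth algebras over a field -/

/-- A ring is a domain if, up to units, it is the image of a ring under a homomorphism whose kernel is
generated by a prime element. -/
theorem isDomain_of_ker_eq_span_prime {A L : Type*} [CommRing A] [CommRing L] [Nontrivial L]
    (ψ : A →+* L) {π : A} (hπ : Prime π) (hsurj : ∀ l, ∃ a u, IsUnit u ∧ l * u = ψ a)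
    (hker : ∀ a, ψ a = 0 ↔ π ∣ a) : IsDomain L := by
  have : NoZeroDivisors L := by
    refine ⟨fun {l l'} h => ?_⟩
    obtain ⟨a, u, hu, ha⟩ := hsurj l
    obtain ⟨a', u', hu', ha'⟩ := hsurj l'
    have h1 : ψ (a * a') = 0 := by
      rw [map_mul, ← ha, ← ha']
      linear_combination u * u' * h
    rw [hker] at h1
    rcases hπ.dvd_or_dvd h1 with h2 | h2
    · left
      rw [← hker, ← ha] at h2
      exact (hu.mul_left_eq_zero).mp h2
    · right
      rw [← hker, ← ha'] at h2
      exact (hu'.mul_left_eq_zero).mp h2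
  exact NoZeroDivisors.to_isDomain L

open Polynomial in
theorem StandardEtalePresentation.exists_dvd_of_aeval_eq_zero {R S : Type*} [CommRing R]
    [CommRing S] [Algebra R S] (P : StandardEtalePresentation R S) (p : R[X])
    (hp : aeval P.x p = 0) : ∃ n : ℕ, P.f ∣ P.g ^ n * p := by
  have h1 : algebraMap (AdjoinRoot P.f) (Localization.Away (AdjoinRoot.mk P.f P.g))
      (AdjoinRoot.mk P.f p) = 0 := by
    have h2 := congrArg (P.equivRing.trans P.P.equivAwayAdjoinRoot) hp
    rw [map_zero] at h2
    rw [← h2]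
    have h3 : (Algebra.algHom R (AdjoinRoot P.f)
        (Localization.Away (AdjoinRoot.mk P.f P.g))).comp (AdjoinRoot.mkₐ P.f) =
        ((P.equivRing.trans P.P.equivAwayAdjoinRoot : S ≃ₐ[R] _) : S →ₐ[R] _).comp
          (aeval P.x) := by
      apply Polynomial.algHom_ext
      simp [StandardEtalePair.equivAwayAdjoinRoot, Algebra.algHom]
      exact (P.P.lift_X _ _).symm
    exact DFunLike.congr_fun h3 p
  rw [IsLocalization.map_eq_zero_iff (Submonoid.powers (AdjoinRoot.mk P.f P.g))] at h1
  obtain ⟨⟨_, n, rfl⟩, hn⟩ := h1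
  refine ⟨n, ?_⟩
  rw [← AdjoinRoot.mk_eq_zero]
  simpa using hn

/-- The local rings of a smooth algebra over a field are domains. Locally such an algebra is standard
étale over a polynomial ring, of the form `(P[X] / f)_g`. At a prime where `f' ≠ 0`, exactly one prime
factor of `f` vanishes, and it has multiplicity one. -/
theorem isDomain_localization_of_smooth (k : Type*) {S : Type*} [Field k] [CommRing S] [Algebra k S]
    [Algebra.Smooth k S] (p : Ideal S) [p.IsPrime] : IsDomain (Localization.AtPrime p) := by
  obtain ⟨f, hfp, n, _, _, ⟨⟨P⟩⟩⟩ :=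
    Algebra.IsSmoothAt.exists_isStandardEtale_mvPolynomial (R := k) (p := p)
  set L := Localization.AtPrime p
  have hunit (t : S) (ht : t ∉ p) : IsUnit (algebraMap S L t) :=
    IsLocalization.map_units L (⟨t, ht⟩ : p.primeCompl)
  let θ : Localization.Away f →+* L := IsLocalization.Away.lift f (hunit f hfp)
  have hθ (s : S) : θ (algebraMap S _ s) = algebraMap S L s := IsLocalization.Away.lift_eq f _ s
  let ψ₀ : Polynomial (MvPolynomial (Fin n) k) →+* Localization.Away f :=
    (Polynomial.aeval (R := MvPolynomial (Fin n) k) P.x).toRingHom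
  let ψ : Polynomial (MvPolynomial (Fin n) k) →+* L := θ.comp ψ₀
  have hg : IsUnit (ψ P.g) := P.hasMap.2.map θ
  have hder : IsUnit (ψ P.f.derivative) := P.hasMap.isUnit_derivative_f.map θ
  have hf0 : ψ P.f = 0 := by
    change θ (Polynomial.aeval P.x P.f) = 0
    rw [P.hasMap.1, map_zero]
  -- the prime factor of `P.f` vanishing at `p`
  obtain ⟨π, hπ, ⟨v, hv⟩, hπq⟩ : ∃ π, Prime π ∧ π ∣ P.f ∧ ¬ IsUnit (ψ π) := by
    by_contra! hcon
    have : ∀ h : Polynomial (MvPolynomial (Fin n) k), h ≠ 0 → h ∣ P.f → IsUnit (ψ h) := by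
      intro h
      induction h using UniqueFactorizationMonoid.induction_on_prime with
      | h₁ => intro h; exact absurd rfl h
      | h₂ x hx => intro _ _; exact hx.map ψ
      | h₃ a π ha hπ ih =>
        intro _ hdvd
        rw [map_mul]
        exact (hcon π hπ (dvd_of_mul_right_dvd hdvd)).mul (ih ha (dvd_of_mul_left_dvd hdvd))
    have h1 := this P.f P.monic_f.ne_zero dvd_rfl
    rw [hf0] at h1
    exact not_isUnit_zero h1
  have hnonunit (a) : ¬ IsUnit (ψ a) ↔ ψ a ∈ IsLocalRing.maximalIdeal L := by
    rw [IsLocalRing.mem_maximalIdeal, mem_nonunits_iff]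
  have hπdvd (a) (h : π ∣ a) : ¬ IsUnit (ψ a) := fun hu => hπq (isUnit_of_dvd_unit (map_dvd ψ h) hu)
  have hvunit : IsUnit (ψ v) := by
    by_contra hvn
    have h1 : ψ P.f.derivative = ψ π.derivative * ψ v + ψ π * ψ v.derivative := by
      rw [hv, Polynomial.derivative_mul, map_add, map_mul, map_mul]
    have h2 : ψ P.f.derivative ∈ IsLocalRing.maximalIdeal L := by
      rw [h1]
      exact add_mem (Ideal.mul_mem_left _ _ ((hnonunit v).mp hvn))
        (Ideal.mul_mem_right _ _ ((hnonunit π).mp hπq))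
    exact (hnonunit _).mpr h2 hder
  have hπ0 : ψ π = 0 := by
    rw [hv, map_mul] at hf0
    exact hvunit.mul_left_eq_zero.mp hf0
  refine isDomain_of_ker_eq_span_prime ψ hπ (fun l => ?_) fun a => ⟨fun ha => ?_, ?_⟩
  · obtain ⟨⟨s, t⟩, hst⟩ := IsLocalization.surj p.primeCompl l
    obtain ⟨a, m, ha⟩ := P.exists_mul_aeval_x_g_pow_eq_aeval_x (algebraMap S _ s)
    refine ⟨a, algebraMap S L t * ψ P.g ^ m, (hunit t t.2).mul (hg.pow m), ?_⟩
    have h1 := congrArg θ ha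
    rw [map_mul, map_pow, hθ] at h1
    rw [← mul_assoc, hst]
    exact h1
  · obtain ⟨⟨s, ⟨_, i, rfl⟩⟩, hs⟩ := IsLocalization.surj (Submonoid.powers f) (ψ₀ a)
    have h1 : algebraMap S L s = 0 := by
      rw [← hθ, ← hs, map_mul]
      change ψ a * _ = 0
      rw [ha, zero_mul]
    rw [IsLocalization.map_eq_zero_iff p.primeCompl] at h1
    obtain ⟨t, ht⟩ := h1
    have h2 : algebraMap S (Localization.Away f) t * ψ₀ a = 0 := by
      have hu : IsUnit (algebraMap S (Localization.Away f) (f ^ i)) :=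
        IsLocalization.map_units _ (⟨f ^ i, i, rfl⟩ : Submonoid.powers f)
      refine hu.mul_left_eq_zero.mp ?_
      rw [mul_assoc, hs, ← map_mul, ht, map_zero]
    obtain ⟨b, m, hb⟩ := P.exists_mul_aeval_x_g_pow_eq_aeval_x (algebraMap S _ (t : S))
    have hbunit : IsUnit (ψ b) := by
      have h3 := congrArg θ hb
      rw [map_mul, map_pow, hθ] at h3
      change _ = ψ b at h3
      rw [← h3]
      exact (hunit t t.2).mul (hg.pow m)
    have h4 : Polynomial.aeval P.x (b * a) = 0 := by
      rw [map_mul, ← hb]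
      change _ * ψ₀ a = 0
      linear_combination (Polynomial.aeval P.x) P.g ^ m * h2
    obtain ⟨j, hj⟩ := P.exists_dvd_of_aeval_eq_zero _ h4
    have h5 : π ∣ P.g ^ j * (b * a) := (Dvd.intro v hv.symm).trans hj
    rcases hπ.dvd_or_dvd h5 with h6 | h6
    · exact absurd (hg.pow j) (by rw [← map_pow]; exact hπdvd _ h6)
    · rcases hπ.dvd_or_dvd h6 with h7 | h7
      · exact absurd hbunit (hπdvd _ h7)
      · exact h7
  · rintro ⟨b, rfl⟩
    rw [map_mul, hπ0, zero_mul]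

/-! ### Generizations in smooth schemes -/

theorem AlgebraicGeometry.Smooth.isDomain_stalk {k : Type u} [Field k] {X : Scheme.{u}}
    (f : X ⟶ Spec (.of k)) [Smooth f] (x : X) : IsDomain (X.presheaf.stalk x) := by
  obtain ⟨_, ⟨V, hV, rfl⟩, hxV, -⟩ :=
    X.isBasis_affineOpens.exists_subset_of_mem_open (Set.mem_univ x) isOpen_univ
  replace hV : IsAffineOpen V := hV
  obtain ⟨φ, hφ⟩ := Spec.map_surjective (hV.fromSpec ≫ f)
  have hsm : Smooth (Spec.map φ) := by
    rw [hφ]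
    exact HasRingHomProperty.comp_of_isOpenImmersion @Smooth hV.fromSpec f ‹_›
  rw [HasRingHomProperty.Spec_iff (P := @Smooth)] at hsm
  algebraize [φ.hom]
  have hdom := isDomain_localization_of_smooth k (hV.primeIdealOf ⟨x, hxV⟩).asIdeal
  let := TopCat.Presheaf.algebra_section_stalk X.presheaf (⟨x, hxV⟩ : V)
  have := hV.isLocalization_stalk ⟨x, hxV⟩
  exact (IsLocalization.algEquiv (hV.primeIdealOf ⟨x, hxV⟩).asIdeal.primeCompl
    (Localization.AtPrime (hV.primeIdealOf ⟨x, hxV⟩).asIdeal)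
    (X.presheaf.stalk x)).symm.toRingEquiv.toMulEquiv.isDomain _

/-- In a scheme whose local rings are domains, each point `x` has a generization specializing to all
generizations of `x`, namely the generic point of the spectrum of the local ring. -/
theorem AlgebraicGeometry.Scheme.exists_generization {X : Scheme.{u}}
    (h : ∀ x : X, IsDomain (X.presheaf.stalk x)) (x : X) :
    ∃ g : X, g ⤳ x ∧ ∀ y, y ⤳ x → g ⤳ y := by
  have := h x
  have hspec (y : X) (hy : y ⤳ x) :
      (X.fromSpecStalk x (⊥ : PrimeSpectrum (X.presheaf.stalk x))) ⤳ y := by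
    have hy' : y ∈ Set.range (X.fromSpecStalk x) := by
      rw [Scheme.range_fromSpecStalk]
      exact hy
    obtain ⟨p, rfl⟩ := hy'
    refine Specializes.map ?_ (X.fromSpecStalk x).continuous
    exact (PrimeSpectrum.le_iff_specializes ⊥ p).mp bot_le
  exact ⟨_, hspec x specializes_rfl, hspec⟩

/-- In a T₀ space where each point has a generization specializing to all its generizations, this
generization is the same for any two points related by specialization. -/
theorem Specializes.eq_of_generization {X : Type*} [TopologicalSpace X] [T0Space X] {g : X → X}
    (hg : ∀ x, g x ⤳ x ∧ ∀ y, y ⤳ x → g x ⤳ y) {x y : X} (h : x ⤳ y) : g x = g y := by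
  have h1 : g y ⤳ x := (hg y).2 x h
  have h2 : g x ⤳ g y := (hg x).2 _ h1
  have h3 : g y ⤳ g x := (hg y).2 _ (((hg x).1).trans h)
  exact (h2.antisymm h3).eq

/-! ### Tangent vectors of smooth algebras -/

open TensorProduct KaehlerDifferential in
/-- The space of derivations at a point of a smooth algebra of relative dimension `n` has dimension
at most `n`. -/
theorem finrank_le_of_injective_derivation {k B K W : Type u} [Field k] [CommRing B] [Algebra k B]
    [Field K] [Algebra k K] [Algebra B K] [IsScalarTower k B K] [AddCommGroup W] [Module K W] {n : ℕ}
    (hB : RingHom.Locally (RingHom.IsStandardSmoothOfRelativeDimension n) (algebraMap k B))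
    (j : W →ₗ[K] Derivation k B K) (hj : Function.Injective j) : Module.finrank K W ≤ n := by
  obtain ⟨s, hs, hst⟩ := hB
  obtain ⟨t, hts, ht0⟩ : ∃ t ∈ s, algebraMap B K t ≠ 0 := by
    by_contra! hcon
    have h1 : Ideal.span s ≤ RingHom.ker (algebraMap B K) := Ideal.span_le.mpr hcon
    have h2 : (1 : B) ∈ RingHom.ker (algebraMap B K) := h1 (hs ▸ Submodule.mem_top)
    rw [RingHom.mem_ker, map_one] at h2
    exact one_ne_zero h2
  let C := Localization.Away t
  have hC := hst t hts
  rw [← IsScalarTower.algebraMap_eq k B C] at hC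
  have hC' : Algebra.IsStandardSmoothOfRelativeDimension n k C := by
    rwa [← RingHom.isStandardSmoothOfRelativeDimension_algebraMap]
  have hC'' : Algebra.IsStandardSmooth k C :=
    Algebra.IsStandardSmoothOfRelativeDimension.isStandardSmooth n
  let _ : Algebra C K := (IsLocalization.Away.lift t (ht0.isUnit) : C →+* K).toAlgebra
  have : IsScalarTower B C K := IsScalarTower.of_algebraMap_eq fun b =>
    (IsLocalization.Away.lift_eq t ht0.isUnit b).symm
  have : Nontrivial C := (algebraMap C K).domain_nontrivial
  have hrank := Algebra.IsStandardSmoothOfRelativeDimension.rank_kaehlerDifferential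
    (R := k) (S := C) n
  have : Module.Finite C (Ω[C⁄k]) := inferInstance
  let e := Module.finBasisOfFinrankEq C (Ω[C⁄k]) (Module.finrank_eq_of_rank_eq hrank)
  have : Algebra.FormallyEtale B C := Algebra.FormallyEtale.of_isLocalization (Submonoid.powers t)
  let ε := tensorKaehlerEquivOfFormallyEtale k B C
  let Θ : Derivation k B K →ₗ[K] (Fin n → K) :=
    { toFun := fun D i => D.liftKaehlerDifferential.liftBaseChange C (ε.symm (e i))
      map_add' := fun D D' => by
        have h : (D + D').liftKaehlerDifferential =
            D.liftKaehlerDifferential + D'.liftKaehlerDifferential := by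
          apply Derivation.liftKaehlerDifferential_unique
          ext b
          simp
        funext i
        rw [h]
        exact LinearMap.congr_fun (map_add (LinearMap.liftBaseChangeEquiv C) _ _) _
      map_smul' := fun c D => by
        have h (ω) : (c • D).liftKaehlerDifferential ω = c • D.liftKaehlerDifferential ω := by
          have : (c • D).liftKaehlerDifferential = c • D.liftKaehlerDifferential := by
            apply Derivation.liftKaehlerDifferential_unique
            ext b
            simp
          rw [this, LinearMap.smul_apply]
        funext i
        rw [RingHom.id_apply, Pi.smul_apply]
        generalize ε.symm (e i) = x
        induction x with
        | zero => simp
        | tmul c' ω => simp [h]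
        | add x y hx hy => rw [map_add, map_add, hx, hy, smul_add] }
  have hΘ : Function.Injective Θ := by
    rw [injective_iff_map_eq_zero]
    intro D hD
    have h1 : D.liftKaehlerDifferential.liftBaseChange C ∘ₗ ε.symm.toLinearMap = 0 :=
      e.ext fun i => congrFun hD i
    ext b
    have h2 := LinearMap.congr_fun h1 (ε (1 ⊗ₜ KaehlerDifferential.D k B b))
    simpa using h2
  have := LinearMap.finrank_le_finrank_of_injective (f := Θ.comp j) (hΘ.comp hj)
  simpa using this

/-- A linear family of tangent vectors, given as homomorphisms to the dual numbers, at a point of a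
smooth algebra of relative dimension `n` has dimension at most `n`. -/
theorem finrank_le_of_dualNumber {k B K W : Type u} [Field k] [CommRing B] [Algebra k B]
    [Field K] [Algebra k K] [AddCommGroup W] [Module K W] {n : ℕ}
    (hB : RingHom.Locally (RingHom.IsStandardSmoothOfRelativeDimension n) (algebraMap k B))
    (g : B →ₐ[k] K) (H : W → B →ₐ[k] DualNumber K) (hfst : ∀ w b, (H w b).fst = g b)
    (hadd : ∀ w w' b, (H (w + w') b).snd = (H w b).snd + (H w' b).snd)
    (hsmul : ∀ (t : K) w b, (H (t • w) b).snd = t * (H w b).snd)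
    (hinj : ∀ w, (∀ b, (H w b).snd = 0) → w = 0) : Module.finrank K W ≤ n := by
  let _ : Algebra B K := g.toRingHom.toAlgebra
  have : IsScalarTower k B K := IsScalarTower.of_algebraMap_eq fun r => (g.commutes r).symm
  have hsm (b : B) (x : K) : b • x = g b * x := rfl
  let j : W →ₗ[K] Derivation k B K :=
    { toFun := fun w => Derivation.mk'
        { toFun := fun b => (H w b).snd
          map_add' := fun b b' => by simp
          map_smul' := fun r b => by simp }
        fun b b' => by
          simp only [LinearMap.coe_mk, AddHom.coe_mk, map_mul, TrivSqZeroExt.snd_mul, hfst, hsm,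
            smul_eq_mul, MulOpposite.smul_eq_mul_unop, MulOpposite.unop_op]
          ring
      map_add' := fun w w' => by
        ext b
        exact hadd w w' b
      map_smul' := fun t w => by
        ext b
        exact hsmul t w b }
  refine finrank_le_of_injective_derivation hB j ?_
  rw [injective_iff_map_eq_zero]
  intro w hw
  exact hinj w fun b => DFunLike.congr_fun hw b

/-- The Taylor expansion of order one of a polynomial. -/
theorem MvPolynomial.aeval_inl_add_inr {k K σ : Type*} [Field k] [Field K] [Algebra k K] [Fintype σ]
    (a v : σ → K) (f : MvPolynomial σ k) :
    MvPolynomial.aeval (fun p => (TrivSqZeroExt.inl (a p) + TrivSqZeroExt.inr (v p) : DualNumber K)) f =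
      TrivSqZeroExt.inl (MvPolynomial.aeval a f) +
        TrivSqZeroExt.inr (∑ p, MvPolynomial.aeval a (MvPolynomial.pderiv p f) * v p) := by
  classical
  induction f using MvPolynomial.induction_on with
  | C r =>
    simp only [MvPolynomial.aeval_C, MvPolynomial.pderiv_C, map_zero, zero_mul,
      Finset.sum_const_zero, TrivSqZeroExt.inr_zero, add_zero]
    rfl
  | add f g hf hg =>
    simp only [map_add, hf, hg, add_mul, Finset.sum_add_distrib, TrivSqZeroExt.inl_add,
      TrivSqZeroExt.inr_add]
    abel
  | mul_X f i hf =>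
    rw [map_mul, hf, MvPolynomial.aeval_X]
    ext
    · simp
    · simp [MvPolynomial.pderiv_X, Pi.single_apply, add_mul, Finset.sum_add_distrib,
        Finset.mul_sum, mul_comm, mul_left_comm, mul_add, mul_ite,
        apply_ite (MvPolynomial.aeval a)]

section Intersections

attribute [local instance] MvPolynomial.gradedAlgebra

/-! ### Tangent spaces of complete intersections -/

section Chart

variable {k A : Type u} [Field k] [CommRing A] [Algebra k A] (𝒜 : ℕ → Submodule k A)
  [GradedAlgebra 𝒜] {f : A} {m : ℕ} (hf : f ∈ 𝒜 m) (hm : 0 < m)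

/-- The structure homomorphism of the coordinate ring of a standard affine chart of `Proj 𝒜`. -/
noncomputable def awayStructureMap (f : A) : k →+* HomogeneousLocalization.Away 𝒜 f :=
  (HomogeneousLocalization.fromZeroRingHom 𝒜 (Submonoid.powers f)).comp (algebraMap k (𝒜 0))

theorem awayι_projStructureMap : Proj.awayι 𝒜 f hf hm ≫ projStructureMap 𝒜 =
    Spec.map (CommRingCat.ofHom (awayStructureMap 𝒜 f)) := by
  rw [projStructureMap, Proj.awayι_toSpecZero_assoc, ← Spec.map_comp, ← CommRingCat.ofHom_comp]
  rfl

end Chart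

section Intersection

variable {k : Type u} [Field k] {N c d : ℕ} {F : Fin c → MvPolynomial (Fin (N + 1)) k}
  {hF : ∀ i, (F i).IsHomogeneous d}

/-- The homomorphism from the homogeneous coordinate ring of an intersection of hypersurfaces given by
a solution of the equations. -/
noncomputable def evalCoordinateRing (hF : ∀ i, (F i).IsHomogeneous d) {R : Type*} [CommRing R]
    [Algebra k R] (a : Fin (N + 1) → R) (ha : ∀ i, MvPolynomial.aeval a (F i) = 0) :
    (MvPolynomial (Fin (N + 1)) k ⧸ (formsIdeal F hF).toIdeal) →ₐ[k] R :=
  Ideal.Quotient.liftₐ _ (MvPolynomial.aeval a) fun f hf => by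
    have h : (formsIdeal F hF).toIdeal ≤ RingHom.ker (MvPolynomial.aeval (R := k) a) := by
      refine Ideal.span_le.mpr ?_
      rintro _ ⟨i, rfl⟩
      exact ha i
    exact h hf

theorem evalCoordinateRing_mk {R : Type*} [CommRing R] [Algebra k R] (a : Fin (N + 1) → R)
    (ha : ∀ i, MvPolynomial.aeval a (F i) = 0) (f : MvPolynomial (Fin (N + 1)) k) :
    evalCoordinateRing hF a ha (Ideal.Quotient.mk (formsIdeal F hF).toIdeal f) = MvPolynomial.aeval a f :=
  rfl

/-- The differential of the equations of a smooth complete intersection is surjective at each point,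
over any extension field. The tangent vectors in the affine chart `xᵢ ≠ 0` embed into the space of
derivations at the point, whose dimension is at most the dimension `N - c` of the intersection. -/
theorem IsSmoothCompleteIntersection.exists_sum_pderiv_eq
    (hX : IsSmoothCompleteIntersection F hF) {K : Type u} [Field K] [Algebra k K]
    (a : Fin (N + 1) → K) (ha0 : a ≠ 0) (ha : ∀ i, MvPolynomial.aeval a (F i) = 0)
    (τ : Fin c → K) :
    ∃ v : Fin (N + 1) → K,
      ∀ i, ∑ p, MvPolynomial.aeval a (MvPolynomial.pderiv p (F i)) * v p = τ i := by
  obtain ⟨hcN, hsm⟩ := hX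
  obtain ⟨i₀, hi₀⟩ := Function.ne_iff.mp ha0
  rw [Pi.zero_apply] at hi₀
  let x : MvPolynomial (Fin (N + 1)) k ⧸ (formsIdeal F hF).toIdeal :=
    Ideal.Quotient.mk (formsIdeal F hF).toIdeal (MvPolynomial.X i₀)
  have hx : x ∈ quotientGrading (formsIdeal F hF) 1 :=
    mk_mem_quotientGrading _ (MvPolynomial.isHomogeneous_X _ _)
  let B := HomogeneousLocalization.Away (quotientGrading (formsIdeal F hF)) x
  let _ : Algebra k B := (awayStructureMap (quotientGrading (formsIdeal F hF)) x).toAlgebra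
  have hB : RingHom.Locally (RingHom.IsStandardSmoothOfRelativeDimension (N - c))
      (algebraMap k B) := by
    have h1 := HasRingHomProperty.comp_of_isOpenImmersion (@SmoothOfRelativeDimension (N - c))
      (Proj.awayι _ x hx one_pos) _ hsm
    rw [awayι_projStructureMap,
      HasRingHomProperty.Spec_iff (P := @SmoothOfRelativeDimension (N - c))] at h1
    exact h1
  -- the homomorphism on the chart given by a solution with invertible coordinate `i₀`
  have hlift {R : Type u} [CommRing R] [Algebra k R] (b : Fin (N + 1) → R)
      (hb : ∀ i, MvPolynomial.aeval b (F i) = 0) (hu : IsUnit (b i₀)) :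
      ∃ h : B →ₐ[k] R, ∀ (y : B) (s : ℕ) (f : MvPolynomial (Fin (N + 1)) k),
        y.val * algebraMap _ (Localization.Away x) x ^ s =
          algebraMap _ (Localization.Away x) (Ideal.Quotient.mk (formsIdeal F hF).toIdeal f) →
        h y * b i₀ ^ s = MvPolynomial.aeval b f := by
    have hu' : IsUnit ((evalCoordinateRing hF b hb).toRingHom x) := by
      change IsUnit (MvPolynomial.aeval b (MvPolynomial.X i₀))
      rwa [MvPolynomial.aeval_X]
    let l : Localization.Away x →+* R := IsLocalization.Away.lift x hu'
    have hl (y) : l (algebraMap _ _ y) = evalCoordinateRing hF b hb y :=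
      IsLocalization.Away.lift_eq x hu' y
    refine ⟨{ toRingHom := l.comp (algebraMap B (Localization.Away x)), commutes' := fun r => ?_ },
      fun y s f hy => ?_⟩
    · change l (algebraMap (MvPolynomial (Fin (N + 1)) k ⧸ (formsIdeal F hF).toIdeal) (Localization.Away x)
        (algebraMap k (MvPolynomial (Fin (N + 1)) k ⧸ (formsIdeal F hF).toIdeal) r)) = _
      rw [hl, AlgHom.commutes]
    · have h1 := congrArg l hy
      rw [map_mul, map_pow, hl, hl] at h1
      change _ * MvPolynomial.aeval b (MvPolynomial.X i₀) ^ s = _ at h1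
      rw [MvPolynomial.aeval_X] at h1
      exact h1
  have hfrac (y : B) : ∃ (s : ℕ) (f : MvPolynomial (Fin (N + 1)) k),
      y.val * algebraMap _ (Localization.Away x) x ^ s =
          algebraMap _ (Localization.Away x) (Ideal.Quotient.mk (formsIdeal F hF).toIdeal f) := by
    obtain ⟨⟨f, ⟨_, s, rfl⟩⟩, h⟩ := IsLocalization.surj (Submonoid.powers x) y.val
    obtain ⟨f, rfl⟩ := Ideal.Quotient.mk_surjective f
    exact ⟨s, f, by rw [← h, map_pow]⟩
  let Ψ : (Fin (N + 1) → K) →ₗ[K] (Fin c → K) × K :=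
    (LinearMap.pi fun i => ∑ p, MvPolynomial.aeval a (MvPolynomial.pderiv p (F i)) •
      LinearMap.proj p).prod (LinearMap.proj i₀)
  have hΨ (v i) : (Ψ v).1 i = ∑ p, MvPolynomial.aeval a (MvPolynomial.pderiv p (F i)) * v p := by
    simp [Ψ]
  have hker : Module.finrank K (LinearMap.ker Ψ) ≤ N - c := by
    obtain ⟨g, hg⟩ := hlift a ha hi₀.isUnit
    have htan (v : LinearMap.ker Ψ) (i) : MvPolynomial.aeval
        (fun p => (TrivSqZeroExt.inl (a p) + TrivSqZeroExt.inr (v.1 p) : DualNumber K)) (F i) = 0 := by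
      rw [MvPolynomial.aeval_inl_add_inr, ha, ← hΨ, LinearMap.mem_ker.mp v.2]
      simp
    have hv0 (v : LinearMap.ker Ψ) : v.1 i₀ = 0 := congrArg Prod.snd (LinearMap.mem_ker.mp v.2)
    choose H hH using fun v : LinearMap.ker Ψ => hlift _ (htan v) (by
      rw [TrivSqZeroExt.isUnit_iff_isUnit_fst]
      simpa using hi₀)
    have hH' (v : LinearMap.ker Ψ) {y : B} {s : ℕ} {f : MvPolynomial (Fin (N + 1)) k}
        (h : y.val * algebraMap _ (Localization.Away x) x ^ s =
          algebraMap _ (Localization.Away x) (Ideal.Quotient.mk (formsIdeal F hF).toIdeal f)) :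
        H v y * TrivSqZeroExt.inl (a i₀ ^ s) = TrivSqZeroExt.inl (MvPolynomial.aeval a f) +
          TrivSqZeroExt.inr (∑ p, MvPolynomial.aeval a (MvPolynomial.pderiv p f) * v.1 p) := by
      rw [← MvPolynomial.aeval_inl_add_inr, ← hH v y s f h, hv0, TrivSqZeroExt.inr_zero, add_zero,
        TrivSqZeroExt.inl_pow]
    have hsnd (v : LinearMap.ker Ψ) {y : B} {s : ℕ} {f : MvPolynomial (Fin (N + 1)) k}
        (h : y.val * algebraMap _ (Localization.Away x) x ^ s =
          algebraMap _ (Localization.Away x) (Ideal.Quotient.mk (formsIdeal F hF).toIdeal f)) :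
        (H v y).snd =
          (a i₀ ^ s)⁻¹ * ∑ p, MvPolynomial.aeval a (MvPolynomial.pderiv p f) * v.1 p := by
      have h1 := congrArg TrivSqZeroExt.snd (hH' v h)
      simp at h1
      rw [← h1]
      field_simp
    refine finrank_le_of_dualNumber hB g H (fun v y => ?_) (fun v v' y => ?_) (fun t v y => ?_)
      fun v hv => ?_
    · obtain ⟨s, f, h⟩ := hfrac y
      have h1 := congrArg TrivSqZeroExt.fst (hH' v h)
      simp at h1
      rw [← hg y s f h] at h1
      exact mul_right_cancel₀ (pow_ne_zero s hi₀) h1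
    · obtain ⟨s, f, h⟩ := hfrac y
      rw [hsnd _ h, hsnd _ h, hsnd _ h, ← mul_add, ← Finset.sum_add_distrib]
      simp [mul_add]
    · obtain ⟨s, f, h⟩ := hfrac y
      rw [hsnd _ h, hsnd _ h, mul_left_comm, Finset.mul_sum _ _ t]
      simp [mul_left_comm]
    · ext p
      let y : B := HomogeneousLocalization.Away.mk _ hx 1
        (Ideal.Quotient.mk (formsIdeal F hF).toIdeal (MvPolynomial.X p)) (mk_mem_quotientGrading _ (by
          simpa using MvPolynomial.isHomogeneous_X _ _))
      have hy : y.val * algebraMap _ (Localization.Away x) x ^ 1 =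
          algebraMap _ (Localization.Away x) (Ideal.Quotient.mk (formsIdeal F hF).toIdeal (MvPolynomial.X p)) := by
        rw [HomogeneousLocalization.Away.val_mk, Localization.mk_eq_mk']
        have h1 := IsLocalization.mk'_spec (Localization.Away x)
          (Ideal.Quotient.mk (formsIdeal F hF).toIdeal (MvPolynomial.X p))
          (⟨x ^ 1, 1, rfl⟩ : Submonoid.powers x)
        rwa [map_pow] at h1
      have h1 := hv y
      rw [hsnd v hy] at h1
      simpa [MvPolynomial.pderiv_X, Pi.single_apply, hi₀, apply_ite (MvPolynomial.aeval a)] using h1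
  have hsurj : Function.Surjective Ψ := by
    rw [← LinearMap.range_eq_top]
    apply Submodule.eq_top_of_finrank_eq
    have h1 := LinearMap.finrank_range_add_finrank_ker Ψ
    have h2 := Submodule.finrank_le (LinearMap.range Ψ)
    simp only [Module.finrank_fin_fun, Module.finrank_prod, Module.finrank_self] at h1 h2 ⊢
    omega
  obtain ⟨v, hv⟩ := hsurj (τ, 0)
  exact ⟨v, fun i => by rw [← hΨ, hv]⟩

end Intersection

/-! ### Points of an intersection of hypersurfaces -/

theorem MvPolynomial.IsHomogeneous.aeval_smul {σ k R : Type*} [CommSemiring k] [CommSemiring R]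
    [Algebra k R] {f : MvPolynomial σ k} {m : ℕ} (hf : f.IsHomogeneous m) (t : R) (a : σ → R) :
    MvPolynomial.aeval (t • a) f = t ^ m * MvPolynomial.aeval a f := by
  rw [MvPolynomial.aeval_def, MvPolynomial.aeval_def, MvPolynomial.eval₂_eq, MvPolynomial.eval₂_eq,
    Finset.mul_sum]
  refine Finset.sum_congr rfl fun d hd => ?_
  have h : ∑ i ∈ d.support, d i = m := by
    have h1 := hf (MvPolynomial.mem_support_iff.mp hd)
    simpa [Finsupp.weight_apply, Finsupp.sum] using h1
  simp only [Pi.smul_apply, smul_eq_mul, mul_pow, Finset.prod_mul_distrib, Finset.prod_pow_eq_pow_sum, h]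
  ring

theorem MvPolynomial.IsHomogeneous.aeval_zero_eq_zero {σ k R : Type*} [CommSemiring k]
    [CommSemiring R] [Algebra k R] {f : MvPolynomial σ k} {m : ℕ} (hf : f.IsHomogeneous m)
    (hm : m ≠ 0) : MvPolynomial.aeval (0 : σ → R) f = 0 := by
  have h := hf.aeval_smul (0 : R) 0
  rwa [zero_pow hm, zero_mul, smul_zero] at h

section SolutionPoint

variable {k : Type u} [Field k] {N c d : ℕ} {F : Fin c → MvPolynomial (Fin (N + 1)) k}
  (hF : ∀ i, (F i).IsHomogeneous d)

/-- The point of the intersection of the hypersurfaces `Fᵢ = 0` given by a nonzero solution `a` of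
these equations in a domain `R`. Its homogeneous ideal is generated by the forms vanishing at `a`. -/
noncomputable def solutionPoint {R : Type*} [CommRing R] [IsDomain R] [Algebra k R]
    (a : Fin (N + 1) → R) (ha0 : a ≠ 0) (ha : ∀ i, MvPolynomial.aeval a (F i) = 0) :
    intersectionScheme F hF :=
  show ProjectiveSpectrum (quotientGrading (formsIdeal F hF)) from
  { asHomogeneousIdeal := (RingHom.ker (evalCoordinateRing hF a ha)).homogeneousCore _
    isPrime := (RingHom.ker_isPrime (evalCoordinateRing hF a ha)).homogeneousCore
    not_irrelevant_le := fun h => ha0 <| funext fun j => by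
      have h1 := Ideal.toIdeal_homogeneousCore_le (quotientGrading (formsIdeal F hF))
        (RingHom.ker (evalCoordinateRing hF a ha)) (h (HomogeneousIdeal.mem_irrelevant_of_mem _ one_pos
          (mk_mem_quotientGrading (formsIdeal F hF) (MvPolynomial.isHomogeneous_X k j))))
      rw [RingHom.mem_ker, evalCoordinateRing_mk, MvPolynomial.aeval_X] at h1
      exact h1 }

/-- The homogeneous ideal of a point of an intersection of hypersurfaces. -/
def pointIdeal (x : intersectionScheme F hF) : HomogeneousIdeal (quotientGrading (formsIdeal F hF)) :=
  ProjectiveSpectrum.asHomogeneousIdeal (𝒜 := quotientGrading (formsIdeal F hF)) x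

theorem mk_mem_pointIdeal_solutionPoint {R : Type*} [CommRing R] [IsDomain R] [Algebra k R]
    (a : Fin (N + 1) → R) (ha0 : a ≠ 0) (ha : ∀ i, MvPolynomial.aeval a (F i) = 0) {m : ℕ}
    {f : MvPolynomial (Fin (N + 1)) k} (hf : f.IsHomogeneous m) :
    Ideal.Quotient.mk (formsIdeal F hF).toIdeal f ∈ pointIdeal hF (solutionPoint hF a ha0 ha) ↔
      MvPolynomial.aeval a f = 0 := by
  constructor
  · intro h
    exact Ideal.toIdeal_homogeneousCore_le (quotientGrading (formsIdeal F hF))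
      (RingHom.ker (evalCoordinateRing hF a ha)) h
  · intro h
    exact Ideal.mem_homogeneousCore_of_homogeneous_of_mem ⟨m, mk_mem_quotientGrading _ hf⟩ h

theorem specializes_of_forall_isHomogeneous {x y : intersectionScheme F hF}
    (h : ∀ (m : ℕ) (f : MvPolynomial (Fin (N + 1)) k), f.IsHomogeneous m →
      Ideal.Quotient.mk (formsIdeal F hF).toIdeal f ∈ pointIdeal hF x →
      Ideal.Quotient.mk (formsIdeal F hF).toIdeal f ∈ pointIdeal hF y) : x ⤳ y := by
  rw [specializes_iff_mem_closure]
  refine (ProjectiveSpectrum.le_iff_mem_closure (quotientGrading (formsIdeal F hF)) x y).mp ?_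
  change pointIdeal hF x ≤ pointIdeal hF y
  intro g hg
  classical
  rw [← DirectSum.sum_support_decompose (quotientGrading (formsIdeal F hF)) g]
  refine sum_mem fun m _ => ?_
  have h1 := (pointIdeal hF x).isHomogeneous m hg
  obtain ⟨f, hf, hfg⟩ := (DirectSum.decompose (quotientGrading (formsIdeal F hF)) g m).2
  rw [← hfg] at h1 ⊢
  exact h m f hf h1

theorem solutionPoint_specializes {R R' : Type*} [CommRing R] [IsDomain R] [Algebra k R]
    [CommRing R'] [IsDomain R'] [Algebra k R']
    {a : Fin (N + 1) → R} {ha0 : a ≠ 0} {ha : ∀ i, MvPolynomial.aeval a (F i) = 0}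
    {b : Fin (N + 1) → R'} {hb0 : b ≠ 0} {hb : ∀ i, MvPolynomial.aeval b (F i) = 0}
    (h : ∀ (m : ℕ) (f : MvPolynomial (Fin (N + 1)) k), f.IsHomogeneous m →
      MvPolynomial.aeval a f = 0 → MvPolynomial.aeval b f = 0) :
    solutionPoint hF a ha0 ha ⤳ solutionPoint hF b hb0 hb := by
  refine specializes_of_forall_isHomogeneous hF fun m f hf h1 => ?_
  rw [mk_mem_pointIdeal_solutionPoint hF _ _ _ hf] at h1 ⊢
  exact h m f hf h1

theorem solutionPoint_specializes_of_algHom {R R' : Type*} [CommRing R] [IsDomain R] [Algebra k R]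
    [CommRing R'] [IsDomain R'] [Algebra k R']
    {a : Fin (N + 1) → R} {ha0 : a ≠ 0} {ha : ∀ i, MvPolynomial.aeval a (F i) = 0}
    {b : Fin (N + 1) → R'} {hb0 : b ≠ 0} {hb : ∀ i, MvPolynomial.aeval b (F i) = 0}
    (φ : R →ₐ[k] R') (h : ∀ p, φ (a p) = b p) :
    solutionPoint hF a ha0 ha ⤳ solutionPoint hF b hb0 hb := by
  refine solutionPoint_specializes hF fun m f _ hf => ?_
  rw [← funext h, ← MvPolynomial.comp_aeval_apply, hf, map_zero]

theorem exists_eq_solutionPoint (x : intersectionScheme F hF) :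
    ∃ (R : Type u) (_ : CommRing R) (_ : IsDomain R) (_ : Algebra k R) (a : Fin (N + 1) → R)
      (ha0 : a ≠ 0) (ha : ∀ i, MvPolynomial.aeval a (F i) = 0), x = solutionPoint hF a ha0 ha := by
  have hp : (pointIdeal hF x).toIdeal.IsPrime :=
    ProjectiveSpectrum.isPrime (𝒜 := quotientGrading (formsIdeal F hF)) x
  have hirr : ¬ HomogeneousIdeal.irrelevant _ ≤ pointIdeal hF x :=
    ProjectiveSpectrum.not_irrelevant_le (𝒜 := quotientGrading (formsIdeal F hF)) x
  let A := MvPolynomial (Fin (N + 1)) k ⧸ (formsIdeal F hF).toIdeal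
  let ρ : MvPolynomial (Fin (N + 1)) k →ₐ[k] A ⧸ (pointIdeal hF x).toIdeal :=
    (Ideal.Quotient.mkₐ k (pointIdeal hF x).toIdeal).comp (Ideal.Quotient.mkₐ k (formsIdeal F hF).toIdeal)
  let a : Fin (N + 1) → A ⧸ (pointIdeal hF x).toIdeal := fun p => ρ (MvPolynomial.X p)
  have hev (f : MvPolynomial (Fin (N + 1)) k) : MvPolynomial.aeval a f = ρ f := by
    rw [← MvPolynomial.comp_aeval_apply, MvPolynomial.aeval_X_left_apply]
  have hmem (f : MvPolynomial (Fin (N + 1)) k) : MvPolynomial.aeval a f = 0 ↔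
      Ideal.Quotient.mk (formsIdeal F hF).toIdeal f ∈ pointIdeal hF x := by
    rw [hev]
    exact Ideal.Quotient.eq_zero_iff_mem
  have ha (i) : MvPolynomial.aeval a (F i) = 0 := by
    have h : F i ∈ (formsIdeal F hF).toIdeal := Ideal.subset_span ⟨i, rfl⟩
    rw [hmem, Ideal.Quotient.eq_zero_iff_mem.mpr h]
    exact zero_mem _
  have ha0 : a ≠ 0 := by
    intro h0
    refine hirr ((HomogeneousIdeal.irrelevant_le _).mpr ?_)
    rintro m hm _ ⟨f, hf, rfl⟩
    refine (hmem f).mp ?_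
    rw [h0]
    exact MvPolynomial.IsHomogeneous.aeval_zero_eq_zero hf hm.ne'
  refine ⟨_, inferInstance, inferInstance, inferInstance, a, ha0, ha, ?_⟩
  refine ProjectiveSpectrum.ext (𝒜 := quotientGrading (formsIdeal F hF)) (HomogeneousIdeal.ext' ?_)
  rintro m _ ⟨f, hf, rfl⟩
  exact (hmem f).symm.trans (mk_mem_pointIdeal_solutionPoint hF a ha0 ha hf).symm

end SolutionPoint

/-! ### The determinant of the linear coefficients -/

theorem MvPolynomial.fst_aeval_inl_add_inr {σ k K : Type*} [Fintype σ] [Field k] [Field K] [Algebra k K]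
    (a v : σ → K) (f : MvPolynomial σ k) :
    (MvPolynomial.aeval (fun p => (TrivSqZeroExt.inl (a p) + TrivSqZeroExt.inr (v p) : DualNumber K)) f).fst =
      MvPolynomial.aeval a f := by
  rw [MvPolynomial.aeval_inl_add_inr]
  simp

theorem MvPolynomial.snd_aeval_inl_add_inr {σ k K : Type*} [Fintype σ] [Field k] [Field K] [Algebra k K]
    (a v : σ → K) (f : MvPolynomial σ k) :
    (MvPolynomial.aeval (fun p => (TrivSqZeroExt.inl (a p) + TrivSqZeroExt.inr (v p) : DualNumber K)) f).snd =
      ∑ p, MvPolynomial.aeval a (MvPolynomial.pderiv p f) * v p := by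
  rw [MvPolynomial.aeval_inl_add_inr]
  simp

theorem MvPolynomial.IsHomogeneous.aeval_pderiv_eq {σ k K : Type*} [CommSemiring k] [CommSemiring K]
    [Algebra k K] {f : MvPolynomial σ k} (hf : f.IsHomogeneous 1) (p : σ) (a b : σ → K) :
    MvPolynomial.aeval a (MvPolynomial.pderiv p f) = MvPolynomial.aeval b (MvPolynomial.pderiv p f) := by
  rw [MvPolynomial.totalDegree_eq_zero_iff_eq_C.mp
    (Nat.le_zero.mp (hf.pderiv (i := p)).totalDegree_le), MvPolynomial.aeval_C, MvPolynomial.aeval_C]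

namespace AdaptedCoordinates

section Coordinates

variable {k : Type*} [Field k] {N c n : ℕ} {F : Fin c → MvPolynomial (Fin (N + 1)) k}
  (A : AdaptedCoordinates F n) {K : Type*} [Field K] [Algebra k K]

theorem yCoord_inl_add_inr (a v : Fin (N + 1) → K) (j : Fin c) :
    A.yCoord (fun p => (TrivSqZeroExt.inl (a p) + TrivSqZeroExt.inr (v p) : DualNumber K)) j =
      TrivSqZeroExt.inl (A.yCoord a j) + TrivSqZeroExt.inr (A.yCoord v j) := by
  ext <;> simp [yCoord, Matrix.mulVec, dotProduct, TrivSqZeroExt.algebraMap_eq_inl',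
    TrivSqZeroExt.fst_sum, TrivSqZeroExt.snd_sum]

theorem zCoord_inl_add_inr (a v : Fin (N + 1) → K) (j : Fin (n + 1)) :
    A.zCoord (fun p => (TrivSqZeroExt.inl (a p) + TrivSqZeroExt.inr (v p) : DualNumber K)) j =
      TrivSqZeroExt.inl (A.zCoord a j) + TrivSqZeroExt.inr (A.zCoord v j) := by
  ext <;> simp [zCoord, Matrix.mulVec, dotProduct, TrivSqZeroExt.algebraMap_eq_inl',
    TrivSqZeroExt.fst_sum, TrivSqZeroExt.snd_sum]

theorem point_ne_zero_of_left {R : Type*} [CommRing R] [Algebra k R] {y : Fin c → R}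
    {z : Fin (n + 1) → R} (h : y ≠ 0) : A.point y z ≠ 0 := by
  intro h0
  rw [← A.yCoord_point y z, h0] at h
  refine h (funext fun j => ?_)
  simp [yCoord]

theorem point_ne_zero_of_right {R : Type*} [CommRing R] [Algebra k R] {y : Fin c → R}
    {z : Fin (n + 1) → R} (h : z ≠ 0) : A.point y z ≠ 0 := by
  intro h0
  rw [← A.zCoord_point y z, h0] at h
  refine h (funext fun j => ?_)
  simp [zCoord]

theorem aeval_point_zero {R : Type*} [CommRing R] [Algebra k R] (y : Fin c → R) (i : Fin c) :
    MvPolynomial.aeval (A.point y 0) (F i) = 0 := by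
  rw [A.aeval_point, (A.isHomogeneous_q i).aeval_zero_eq_zero two_ne_zero, add_zero]
  refine Finset.sum_eq_zero fun j _ => ?_
  rw [(A.isHomogeneous_L i j).aeval_zero_eq_zero one_ne_zero, zero_mul]

theorem aeval_det {R : Type*} [CommRing R] [Algebra k R] (z : Fin (n + 1) → R) :
    MvPolynomial.aeval z A.L.det = (A.L.map (MvPolynomial.aeval z)).det :=
  AlgHom.map_det _ _

end Coordinates

variable {k : Type u} [Field k] {N c n : ℕ} {F : Fin c → MvPolynomial (Fin (N + 1)) k}
  {hF : ∀ i, (F i).IsHomogeneous 2} (A : AdaptedCoordinates F n) {K : Type u} [Field K] [Algebra k K]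

/-- Smoothness in adapted coordinates: every `τ` is the value of the equations, to first order, at
a tangent vector. -/
theorem exists_aeval_inl_add_inr (hX : IsSmoothCompleteIntersection F hF) (y : Fin c → K)
    (z : Fin (n + 1) → K) (h0 : A.point y z ≠ 0)
    (h : ∀ i, ∑ j, MvPolynomial.aeval z (A.L i j) * y j + MvPolynomial.aeval z (A.q i) = 0)
    (τ : Fin c → K) : ∃ (v : Fin c → K) (w : Fin (n + 1) → K), ∀ i,
      (∑ j, MvPolynomial.aeval (fun m => (TrivSqZeroExt.inl (z m) + TrivSqZeroExt.inr (w m) : DualNumber K))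
          (A.L i j) * (TrivSqZeroExt.inl (y j) + TrivSqZeroExt.inr (v j)) +
        MvPolynomial.aeval (fun m => (TrivSqZeroExt.inl (z m) + TrivSqZeroExt.inr (w m) : DualNumber K))
          (A.q i)).snd = τ i := by
  obtain ⟨v, hv⟩ := hX.exists_sum_pderiv_eq (A.point y z) h0 (fun i => by rw [A.aeval_point, h]) τ
  refine ⟨A.yCoord v, A.zCoord v, fun i => ?_⟩
  rw [← hv i, ← MvPolynomial.snd_aeval_inl_add_inr]
  congr 1
  rw [← A.point_coord (fun p => (TrivSqZeroExt.inl (A.point y z p) + TrivSqZeroExt.inr (v p) : DualNumber K)),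
    A.aeval_point, funext (A.zCoord_inl_add_inr _ v), funext (A.yCoord_inl_add_inr _ v),
    A.zCoord_point, A.yCoord_point]

/-- A polynomial solution `y = l(z)` of the equations forces the matrix of linear coefficients to be
invertible at each `z ≠ 0`: moving the point along the graph of `l` does not change the equations. -/
theorem aeval_det_ne_zero_of_section (hX : IsSmoothCompleteIntersection F hF)
    (l : Fin c → MvPolynomial (Fin (n + 1)) k) (hl : ∀ i, ∑ j, A.L i j * l j + A.q i = 0)
    (z : Fin (n + 1) → K) (hz : z ≠ 0) : MvPolynomial.aeval z A.L.det ≠ 0 := by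
  rw [A.aeval_det, ← isUnit_iff_ne_zero, ← Matrix.isUnit_iff_isUnit_det,
    ← Matrix.mulVec_surjective_iff_isUnit]
  intro τ
  have hl' {R : Type u} [CommRing R] [Algebra k R] (z : Fin (n + 1) → R) (i) :
      ∑ j, MvPolynomial.aeval z (A.L i j) * MvPolynomial.aeval z (l j) + MvPolynomial.aeval z (A.q i) = 0 := by
    simpa using congrArg (MvPolynomial.aeval z) (hl i)
  obtain ⟨v, w, hvw⟩ := A.exists_aeval_inl_add_inr hX (fun j => MvPolynomial.aeval z (l j)) z
    (A.point_ne_zero_of_right hz) (hl' z) τ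
  let zd : Fin (n + 1) → DualNumber K := fun m => TrivSqZeroExt.inl (z m) + TrivSqZeroExt.inr (w m)
  refine ⟨fun j => v j - (MvPolynomial.aeval zd (l j)).snd, funext fun i => ?_⟩
  have h1 := congrArg TrivSqZeroExt.snd (hl' zd i)
  rw [← hvw i, ← sub_zero (TrivSqZeroExt.snd _), ← TrivSqZeroExt.snd_zero (R := K), ← h1]
  simp only [TrivSqZeroExt.snd_add, TrivSqZeroExt.snd_sum, TrivSqZeroExt.snd_mul, Matrix.mulVec,
    dotProduct, Matrix.map_apply, zd, MvPolynomial.fst_aeval_inl_add_inr, TrivSqZeroExt.fst_add,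
    TrivSqZeroExt.fst_inl, TrivSqZeroExt.fst_inr, TrivSqZeroExt.snd_inl, TrivSqZeroExt.snd_inr,
    smul_eq_mul, MulOpposite.smul_eq_mul_unop, MulOpposite.unop_op, mul_sub, Finset.sum_sub_distrib,
    Finset.sum_add_distrib, zero_add, add_zero]
  ring

/-- A polynomial vector `y` in the kernel of the matrix of linear coefficients forces this matrix to
be invertible at each `z` where `y` does not vanish: the first order variation of the equations at
the point `(y(z), 0)` in the direction `w` is `L(w) y(z) = - L(z) ∂y(w)`. -/
theorem aeval_det_ne_zero_of_ker (hX : IsSmoothCompleteIntersection F hF)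
    (y : Fin c → MvPolynomial (Fin (n + 1)) k) (hy : ∀ i, ∑ j, A.L i j * y j = 0)
    (z : Fin (n + 1) → K) (hz : (fun j => MvPolynomial.aeval z (y j)) ≠ 0) :
    MvPolynomial.aeval z A.L.det ≠ 0 := by
  rw [A.aeval_det, ← isUnit_iff_ne_zero, ← Matrix.isUnit_iff_isUnit_det,
    ← Matrix.mulVec_surjective_iff_isUnit]
  intro τ
  obtain ⟨v, w, hvw⟩ := A.exists_aeval_inl_add_inr hX (fun j => MvPolynomial.aeval z (y j)) 0
    (A.point_ne_zero_of_left hz) (fun i => by rw [← A.aeval_point, A.aeval_point_zero]) τ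
  let zd : Fin (n + 1) → DualNumber K := fun m => TrivSqZeroExt.inl (z m) + TrivSqZeroExt.inr (w m)
  refine ⟨fun j => - (MvPolynomial.aeval zd (y j)).snd, funext fun i => ?_⟩
  have h1 : ∑ j, MvPolynomial.aeval zd (A.L i j) * MvPolynomial.aeval zd (y j) = 0 := by
    simpa using congrArg (MvPolynomial.aeval zd) (hy i)
  replace h1 := congrArg TrivSqZeroExt.snd h1
  have hL (j) (p) : MvPolynomial.aeval (0 : Fin (n + 1) → K) (MvPolynomial.pderiv p (A.L i j)) =
      MvPolynomial.aeval z (MvPolynomial.pderiv p (A.L i j)) :=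
    (A.isHomogeneous_L i j).aeval_pderiv_eq p _ _
  have hL0 (j) : MvPolynomial.aeval (0 : Fin (n + 1) → K) (A.L i j) = 0 :=
    (A.isHomogeneous_L i j).aeval_zero_eq_zero one_ne_zero
  have hq (p) : MvPolynomial.aeval (0 : Fin (n + 1) → K) (MvPolynomial.pderiv p (A.q i)) = 0 :=
    ((A.isHomogeneous_q i).pderiv (i := p)).aeval_zero_eq_zero one_ne_zero
  rw [← hvw i]
  simp only [TrivSqZeroExt.snd_add, TrivSqZeroExt.snd_sum, TrivSqZeroExt.snd_mul, Matrix.mulVec,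
    dotProduct, Matrix.map_apply, zd, MvPolynomial.fst_aeval_inl_add_inr,
    MvPolynomial.snd_aeval_inl_add_inr _ _ (A.L _ _), MvPolynomial.snd_aeval_inl_add_inr _ _ (A.q _),
    TrivSqZeroExt.fst_add,
    TrivSqZeroExt.fst_inl, TrivSqZeroExt.fst_inr, TrivSqZeroExt.snd_inl, TrivSqZeroExt.snd_inr,
    smul_eq_mul, MulOpposite.smul_eq_mul_unop, MulOpposite.unop_op, hL, hL0, hq, Finset.sum_add_distrib, zero_add,
    add_zero, zero_mul, Finset.sum_const_zero, TrivSqZeroExt.snd_zero] at h1 ⊢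
  rw [← sub_eq_zero, ← neg_eq_zero, ← h1]
  simp only [mul_neg, Finset.sum_neg_distrib]
  ring

theorem det_ne_zero (hX : IsSmoothCompleteIntersection F hF) : A.L.det ≠ 0 := by
  intro h0
  obtain ⟨y, hy0, hy⟩ := Matrix.exists_mulVec_eq_zero_iff.mpr h0
  let K := FractionRing (MvPolynomial (Fin (n + 1)) k)
  let z : Fin (n + 1) → K := fun m => algebraMap (MvPolynomial (Fin (n + 1)) k) K (MvPolynomial.X m)
  have hz (f : MvPolynomial (Fin (n + 1)) k) : MvPolynomial.aeval z f = algebraMap _ K f :=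
    (MvPolynomial.aeval_algebraMap_apply K MvPolynomial.X f).trans
      (by rw [MvPolynomial.aeval_X_left_apply])
  refine A.aeval_det_ne_zero_of_ker hX y (fun i => congrFun hy i) z (fun h => hy0 ?_)
    (by rw [h0, map_zero])
  funext j
  have h1 := congrFun h j
  rwa [hz, Pi.zero_apply, FaithfulSMul.algebraMap_eq_zero_iff] at h1

end AdaptedCoordinates

/-! ### Irreducibility -/

theorem UniqueFactorizationMonoid.exists_eq_mul_not_dvd {R ι : Type*} [CommRing R] [IsDomain R]
    [UniqueFactorizationMonoid R] [Fintype ι] [Nonempty ι] (f : ι → R) :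
    ∃ (g : R) (f' : ι → R), (∀ i, f i = g * f' i) ∧ ∀ π, Prime π → ∃ i, ¬ π ∣ f' i := by
  classical
  let _ : StrongNormalizationMonoid R :=
    UniqueFactorizationMonoid.strongNormalizationMonoid
  let _ : NormalizedGCDMonoid R := UniqueFactorizationMonoid.toNormalizedGCDMonoid R
  obtain ⟨f', hf', h1⟩ := Finset.extract_gcd (s := Finset.univ) f Finset.univ_nonempty
  refine ⟨_, f', fun i => hf' i (Finset.mem_univ i), fun π hπ => ?_⟩
  by_contra! h
  refine hπ.not_isUnit (isUnit_of_dvd_one ?_)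
  rw [← h1]
  exact Finset.dvd_gcd fun i _ => h i

namespace AdaptedCoordinates

section Parametrization

variable {k : Type*} [Field k] {N c n : ℕ} {F : Fin c → MvPolynomial (Fin (N + 1)) k}
  (A : AdaptedCoordinates F n)

/-- The numerators `-adj(L) q` of the solution of the equations `L(z) y + q(z) = 0` by Cramer's
rule; the denominator is `det L`. -/
noncomputable def numerator (j : Fin c) : MvPolynomial (Fin (n + 1)) k :=
  -A.L.adjugate.mulVec A.q j

/-- The rational parametrization of the intersection of quadrics by projective space, in homogeneous
form: the point with adapted coordinates `(-adj(L) q, det(L) z)`. -/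
noncomputable def parametrization : Fin (N + 1) → MvPolynomial (Fin (n + 1)) k :=
  A.point A.numerator (A.L.det • MvPolynomial.X)

theorem isHomogeneous_det : A.L.det.IsHomogeneous c := by
  simpa using _root_.isHomogeneous_det A.L A.isHomogeneous_L

theorem sum_mul_numerator (i : Fin c) : ∑ j, A.L i j * A.numerator j + A.L.det * A.q i = 0 := by
  have h1 : A.L.mulVec (A.L.adjugate.mulVec A.q) = A.L.det • A.q := by
    rw [Matrix.mulVec_mulVec, Matrix.mul_adjugate, Matrix.smul_mulVec, Matrix.one_mulVec]
  have h2 := congrFun h1 i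
  rw [Pi.smul_apply, smul_eq_mul, Matrix.mulVec, dotProduct] at h2
  simp only [numerator, mul_neg, Finset.sum_neg_distrib]
  rw [h2, neg_add_cancel]

theorem aeval_parametrization (i : Fin c) : MvPolynomial.aeval A.parametrization (F i) = 0 := by
  rw [parametrization, A.aeval_point, (A.isHomogeneous_q i).aeval_smul,
    MvPolynomial.aeval_X_left_apply]
  simp only [(A.isHomogeneous_L i _).aeval_smul, MvPolynomial.aeval_X_left_apply]
  rw [← mul_zero A.L.det, ← A.sum_mul_numerator i, mul_add, Finset.mul_sum, pow_one, sq]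
  simp only [mul_assoc]

variable {R : Type*} [CommRing R] [Algebra k R]

/-- Cramer's rule for the solutions of the equations. -/
theorem aeval_det_mul_yCoord (a : Fin (N + 1) → R) (ha : ∀ i, MvPolynomial.aeval a (F i) = 0)
    (j : Fin c) : MvPolynomial.aeval (A.zCoord a) A.L.det * A.yCoord a j =
      MvPolynomial.aeval (A.zCoord a) (A.numerator j) := by
  let φ : MvPolynomial (Fin (n + 1)) k →ₐ[k] R := MvPolynomial.aeval (A.zCoord a)
  have h1 : (A.L.map φ).mulVec (A.yCoord a) = -fun i => φ (A.q i) := by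
    funext i
    rw [Pi.neg_apply, eq_neg_iff_add_eq_zero, ← ha i, ← A.point_coord a, A.aeval_point,
      A.point_coord a]
    rfl
  have h2 : ((A.L.adjugate.map φ) * (A.L.map φ)) = φ A.L.det • (1 : Matrix (Fin c) (Fin c) R) := by
    rw [← Matrix.map_mul, Matrix.adjugate_mul]
    ext i j
    by_cases h : i = j <;> simp [h]
  have h3 := congrFun (congrArg (A.L.adjugate.map φ).mulVec h1) j
  rw [Matrix.mulVec_mulVec, h2, Matrix.smul_mulVec, Matrix.one_mulVec, Matrix.mulVec_neg] at h3
  refine Eq.trans h3 ?_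
  change -_ = φ _
  rw [numerator, map_neg]
  simp [Matrix.mulVec, dotProduct]

theorem aeval_zCoord_parametrization (a : Fin (N + 1) → R)
    (ha : ∀ i, MvPolynomial.aeval a (F i) = 0) (p : Fin (N + 1)) :
    MvPolynomial.aeval (A.zCoord a) (A.parametrization p) =
      MvPolynomial.aeval (A.zCoord a) A.L.det * a p := by
  rw [parametrization, A.map_point]
  simp only [← A.aeval_det_mul_yCoord a ha, Pi.smul_apply, smul_eq_mul, map_mul, MvPolynomial.aeval_X]
  have h := congrFun (A.point_smul (MvPolynomial.aeval (A.zCoord a) A.L.det) (A.yCoord a) (A.zCoord a)) p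
  rw [A.point_coord] at h
  exact h

end Parametrization

section Irreducible

variable {k : Type u} [Field k] {N c n : ℕ} {F : Fin c → MvPolynomial (Fin (N + 1)) k}
  {hF : ∀ i, (F i).IsHomogeneous 2} (A : AdaptedCoordinates F n)

theorem parametrization_ne_zero (hX : IsSmoothCompleteIntersection F hF) : A.parametrization ≠ 0 :=
  A.point_ne_zero_of_right fun h => mul_ne_zero (A.det_ne_zero hX) (MvPolynomial.X_ne_zero 0)
    (congrFun h 0)

theorem algHom_det_ne_zero_of_section (hX : IsSmoothCompleteIntersection F hF)
    (l : Fin c → MvPolynomial (Fin (n + 1)) k) (hl : ∀ i, ∑ j, A.L i j * l j + A.q i = 0)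
    {R : Type u} [CommRing R] [IsDomain R] [Algebra k R] (φ : MvPolynomial (Fin (n + 1)) k →ₐ[k] R)
    (hφ : (fun m => φ (MvPolynomial.X m)) ≠ 0) : φ A.L.det ≠ 0 := by
  have hev : φ = MvPolynomial.aeval fun m => φ (MvPolynomial.X m) := MvPolynomial.aeval_unique φ
  intro h
  refine A.aeval_det_ne_zero_of_section hX l hl
    (algebraMap R (FractionRing R) ∘ fun m => φ (MvPolynomial.X m)) (fun h0 => hφ (funext fun m => ?_)) ?_
  · exact (FaithfulSMul.algebraMap_eq_zero_iff R (FractionRing R)).mp (congrFun h0 m)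
  · rw [MvPolynomial.aeval_algebraMap_apply, ← hev, h, map_zero]

/-- The closure of the image of the parametrization meets the linear subspace `z = 0`. After division
of the parametrization `(-adj(L) q, det(L) z)` by the common factors of its coefficients, the remaining
factor of `det L` is not constant, and the parametrization takes values in the linear subspace over a
prime divisor of this factor. -/
theorem exists_parametrization_specializes (hX : IsSmoothCompleteIntersection F hF) (hn : 0 < n)
    (hc : c ≠ 0) :
    ∃ (R : Type u) (_ : CommRing R) (_ : IsDomain R) (_ : Algebra k R) (y : Fin c → R) (hy : y ≠ 0),
      solutionPoint hF A.parametrization (A.parametrization_ne_zero hX) A.aeval_parametrization ⤳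
        solutionPoint hF (A.point y 0) (A.point_ne_zero_of_left hy) (A.aeval_point_zero y) := by
  obtain ⟨g, f', hf', hπ'⟩ := UniqueFactorizationMonoid.exists_eq_mul_not_dvd
    fun s : Option (Fin c) => s.elim A.L.det A.numerator
  have hD := A.det_ne_zero hX
  have hD' : A.L.det = g * f' none := hf' none
  have hg : g ≠ 0 := fun h => hD (by rw [hD', h, zero_mul])
  have hG : f' none ≠ 0 := fun h => hD (by rw [hD', h, mul_zero])
  by_cases hu : IsUnit (f' none)
  · -- the parametrization is polynomial, which is impossible over the hypersurface `det L = 0`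
    exfalso
    obtain ⟨u, hu⟩ := hu
    let l (j : Fin c) : MvPolynomial (Fin (n + 1)) k := ↑u⁻¹ * f' (some j)
    have hl (j) : A.numerator j = A.L.det * l j := by
      have h1 : A.numerator j = g * f' (some j) := hf' (some j)
      rw [h1, hD', ← hu, mul_assoc]
      simp [l]
    have hl' (i) : ∑ j, A.L i j * l j + A.q i = 0 := by
      refine (mul_eq_zero.mp ?_).resolve_left hD
      rw [← A.sum_mul_numerator i, mul_add, Finset.mul_sum]
      simp only [hl, mul_left_comm]
    have hDu : ¬ IsUnit A.L.det := fun h => by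
      have h1 := h.map (MvPolynomial.aeval (0 : Fin (n + 1) → k))
      rw [A.isHomogeneous_det.aeval_zero_eq_zero hc] at h1
      exact not_isUnit_zero h1
    obtain ⟨π, hπ, hπD⟩ := WfDvdMonoid.exists_irreducible_factor hDu hD
    have hprime : (Ideal.span {π}).IsPrime :=
      (Ideal.span_singleton_prime hπ.ne_zero).mpr hπ.prime
    let R := MvPolynomial (Fin (n + 1)) k ⧸ Ideal.span {π}
    let φ : MvPolynomial (Fin (n + 1)) k →ₐ[k] R := Ideal.Quotient.mkₐ k (Ideal.span {π})
    have hφ (f) : φ f = 0 ↔ π ∣ f := by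
      rw [← Ideal.mem_span_singleton]
      exact Ideal.Quotient.eq_zero_iff_mem
    refine A.algHom_det_ne_zero_of_section hX l hl' φ (fun h => ?_) ((hφ _).mpr hπD)
    have h0 : π ∣ MvPolynomial.X (0 : Fin (n + 1)) := (hφ _).mp (congrFun h 0)
    have h1 : π ∣ MvPolynomial.X (Fin.last n) := (hφ _).mp (congrFun h (Fin.last n))
    have h2 := MvPolynomial.X_dvd_X.mp ((hπ.dvd_symm MvPolynomial.X_prime.irreducible h0).trans h1)
    exact hn.ne (congrArg Fin.val h2)
  · obtain ⟨π, hπ, hπG⟩ := WfDvdMonoid.exists_irreducible_factor hu hG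
    have hprime : (Ideal.span {π}).IsPrime :=
      (Ideal.span_singleton_prime hπ.ne_zero).mpr hπ.prime
    let R := MvPolynomial (Fin (n + 1)) k ⧸ Ideal.span {π}
    let φ : MvPolynomial (Fin (n + 1)) k →ₐ[k] R := Ideal.Quotient.mkₐ k (Ideal.span {π})
    have hφ (f) : φ f = 0 ↔ π ∣ f := by
      rw [← Ideal.mem_span_singleton]
      exact Ideal.Quotient.eq_zero_iff_mem
    have hy : (fun j => φ (f' (some j))) ≠ 0 := by
      intro h
      obtain ⟨s, hs⟩ := hπ' π hπ.prime
      cases s with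
      | none => exact hs hπG
      | some j => exact hs ((hφ _).mp (congrFun h j))
    refine ⟨R, inferInstance, inferInstance, inferInstance, _, hy,
      solutionPoint_specializes hF fun m f hf h => ?_⟩
    have h1 : A.parametrization =
        g • A.point (fun j => f' (some j)) (f' none • (MvPolynomial.X : Fin (n + 1) → MvPolynomial (Fin (n + 1)) k)) := by
      rw [← A.point_smul, smul_smul, ← hD', parametrization]
      congr 1
      exact funext fun j => hf' (some j)
    rw [h1, hf.aeval_smul] at h
    have h2 := congrArg φ ((mul_eq_zero.mp h).resolve_left (pow_ne_zero m hg))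
    rw [MvPolynomial.comp_aeval_apply, map_zero] at h2
    rw [← h2]
    congr 2
    funext p
    rw [A.map_point]
    congr 1
    funext m
    simp [(hφ _).mpr hπG]

/-- A smooth complete intersection of quadrics containing the linear subspace `z = 0` is irreducible.
The generic generizations of all points agree: points with `det L(z) ≠ 0` are specializations of the
generic value of the parametrization, and each of the others lies on a line in the intersection which
meets the linear subspace. -/
theorem exists_forall_specializes (A : AdaptedCoordinates F n)
    (hX : IsSmoothCompleteIntersection F hF) (hn : 0 < n) :
    ∃ η : intersectionScheme F hF, ∀ x, η ⤳ x := by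
  have hsm : Smooth (intersectionToSpec F hF) := by
    have := hX.2
    exact SmoothOfRelativeDimension.smooth (N - c) _
  have hst := Smooth.isDomain_stalk (intersectionToSpec F hF)
  choose g hg using Scheme.exists_generization hst
  let η₁ := solutionPoint hF A.parametrization (A.parametrization_ne_zero hX) A.aeval_parametrization
  suffices h : ∀ x, g x = g η₁ from ⟨g η₁, fun x => h x ▸ (hg x).1⟩
  intro x
  obtain ⟨R, _, _, _, a, ha0, ha, rfl⟩ := exists_eq_solutionPoint hF x
  by_cases hz : MvPolynomial.aeval (A.zCoord a) A.L.det = 0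
  · obtain ⟨y, hy0, hy⟩ : ∃ y : Fin c → R, y ≠ 0 ∧
        (A.L.map (MvPolynomial.aeval (A.zCoord a))).mulVec y = 0 :=
      Matrix.exists_mulVec_eq_zero_iff.mpr (by rw [← A.aeval_det, hz])
    have hc : c ≠ 0 := by
      rintro rfl
      exact hy0 (Subsingleton.elim _ _)
    have hY : (MvPolynomial.X : Fin c → MvPolynomial (Fin c) k) ≠ 0 := fun h =>
      MvPolynomial.X_ne_zero (R := k) (⟨0, Nat.pos_of_ne_zero hc⟩ : Fin c) (congrFun h _)
    -- the generic point of the linear subspace `z = 0`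
    let η₂ := solutionPoint hF (A.point MvPolynomial.X 0) (A.point_ne_zero_of_left hY)
      (A.aeval_point_zero MvPolynomial.X)
    have hη₂ {R' : Type u} [CommRing R'] [IsDomain R'] [Algebra k R'] (y : Fin c → R') (hy : y ≠ 0) :
        η₂ ⤳ solutionPoint hF (A.point y 0) (A.point_ne_zero_of_left hy) (A.aeval_point_zero y) := by
      refine solutionPoint_specializes_of_algHom hF (MvPolynomial.aeval y) fun p => ?_
      rw [A.map_point]
      congr 1
      · funext j
        rw [MvPolynomial.aeval_X]
    obtain ⟨R', _, _, _, y', hy', hη₁⟩ := A.exists_parametrization_specializes hX hn hc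
    have h1 : g η₁ = g η₂ := (Specializes.eq_of_generization hg hη₁).trans
      (Specializes.eq_of_generization hg (hη₂ y' hy')).symm
    -- the generic point of the line joining `x` to the point `y` of the linear subspace
    let s : MvPolynomial (Fin 2) R := MvPolynomial.X 0
    let t : MvPolynomial (Fin 2) R := MvPolynomial.X 1
    let b : Fin (N + 1) → MvPolynomial (Fin 2) R :=
      A.point (s • (fun j => MvPolynomial.C (A.yCoord a j)) + t • fun j => MvPolynomial.C (y j))
        (s • fun m => MvPolynomial.C (A.zCoord a m))
    have hC (f : MvPolynomial (Fin (n + 1)) k) : MvPolynomial.aeval (fun m =>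
        (MvPolynomial.C (A.zCoord a m) : MvPolynomial (Fin 2) R)) f =
        MvPolynomial.C (MvPolynomial.aeval (A.zCoord a) f) :=
      MvPolynomial.aeval_algebraMap_apply (MvPolynomial (Fin 2) R) (A.zCoord a) f
    have hb (i) : MvPolynomial.aeval b (F i) = 0 := by
      have e1 : ∑ j, MvPolynomial.aeval (A.zCoord a) (A.L i j) * A.yCoord a j +
          MvPolynomial.aeval (A.zCoord a) (A.q i) = 0 := by
        rw [← A.aeval_point, A.point_coord, ha]
      have e2 : ∑ j, MvPolynomial.aeval (A.zCoord a) (A.L i j) * y j = 0 := congrFun hy i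
      have e1' := congrArg (MvPolynomial.C (σ := Fin 2)) e1
      have e2' := congrArg (MvPolynomial.C (σ := Fin 2)) e2
      simp only [map_add, map_sum, map_mul, map_zero] at e1' e2'
      simp only [b, A.aeval_point, (A.isHomogeneous_q i).aeval_smul, (A.isHomogeneous_L i _).aeval_smul, hC,
        Pi.add_apply, Pi.smul_apply, smul_eq_mul]
      have e3 (j) : s ^ 1 * MvPolynomial.C (MvPolynomial.aeval (A.zCoord a) (A.L i j)) *
          (s * MvPolynomial.C (A.yCoord a j) + t * MvPolynomial.C (y j)) =
          s ^ 2 * (MvPolynomial.C (MvPolynomial.aeval (A.zCoord a) (A.L i j)) *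
            MvPolynomial.C (A.yCoord a j)) +
          s * t * (MvPolynomial.C (MvPolynomial.aeval (A.zCoord a) (A.L i j)) *
            MvPolynomial.C (y j)) := by
        ring
      simp only [e3, Finset.sum_add_distrib, ← Finset.mul_sum]
      linear_combination s ^ 2 * e1' + s * t * e2'
    have hb1 (r r' : R) (p) : (MvPolynomial.aeval ![r, r'] : MvPolynomial (Fin 2) R →ₐ[R] R) (b p) =
        A.point (r • A.yCoord a + r' • y) (r • A.zCoord a) p := by
      have h := A.map_point (R := MvPolynomial (Fin 2) R) (R' := R)
        ((MvPolynomial.aeval ![r, r'] : MvPolynomial (Fin 2) R →ₐ[R] R).restrictScalars k)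
      refine (h _ _ p).trans ?_
      congr 1
      · funext j
        simp [s, t]
      · funext j
        simp [s]
    have hb0 : b ≠ 0 := by
      intro h
      refine ha0 (funext fun p => ?_)
      have h1 := hb1 1 0 p
      rw [h, one_smul, zero_smul, one_smul, add_zero, A.point_coord] at h1
      rw [← h1]
      exact map_zero _
    let β := solutionPoint hF b hb0 hb
    have hβ1 : β ⤳ solutionPoint hF a ha0 ha := by
      refine solutionPoint_specializes_of_algHom hF
        ((MvPolynomial.aeval ![1, 0] : MvPolynomial (Fin 2) R →ₐ[R] R).restrictScalars k) fun p => ?_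
      refine (hb1 1 0 p).trans ?_
      rw [one_smul, zero_smul, one_smul, add_zero, A.point_coord]
    have hβ2 : β ⤳ solutionPoint hF (A.point y 0) (A.point_ne_zero_of_left hy0) (A.aeval_point_zero y) := by
      refine solutionPoint_specializes_of_algHom hF
        ((MvPolynomial.aeval ![0, 1] : MvPolynomial (Fin 2) R →ₐ[R] R).restrictScalars k) fun p => ?_
      refine (hb1 0 1 p).trans ?_
      rw [one_smul, zero_smul, zero_smul, zero_add]
    rw [h1, ← Specializes.eq_of_generization hg hβ1, Specializes.eq_of_generization hg hβ2,
      Specializes.eq_of_generization hg (hη₂ y hy0)]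
  · refine (Specializes.eq_of_generization hg (solutionPoint_specializes hF fun m f hf h => ?_)).symm
    have h1 := congrArg (MvPolynomial.aeval (A.zCoord a)) h
    rw [MvPolynomial.comp_aeval_apply, map_zero,
      funext (A.aeval_zCoord_parametrization a ha)] at h1
    have h2 := (hf.aeval_smul (MvPolynomial.aeval (A.zCoord a) A.L.det) a).symm.trans h1
    exact (mul_eq_zero.mp h2).resolve_left (pow_ne_zero m hz)

end Irreducible

end AdaptedCoordinates

/-! ### The birational parametrization -/

theorem HomogeneousLocalization.Away.map_bijective {k A B : Type*} [CommRing k] [CommRing A] [CommRing B]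
    [Algebra k A] [Algebra k B] {𝒜 : ℕ → Submodule k A} {ℬ : ℕ → Submodule k B} [GradedAlgebra 𝒜]
    [GradedAlgebra ℬ] (g : 𝒜 →+*ᵍ ℬ) {f : A} {d : ℕ} (hf : f ∈ 𝒜 d)
    (hinj : ∀ (m : ℕ), ∀ a ∈ 𝒜 m, g a = 0 → a = 0)
    (hsurj : ∀ (m : ℕ), ∀ b ∈ ℬ m, ∃ a ∈ 𝒜 (m * d + m), g a = g f ^ m * b) :
    Function.Bijective (Away.map g f) := by
  constructor
  · rw [injective_iff_map_eq_zero]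
    intro x hx
    obtain ⟨m, a, ha, rfl⟩ := Away.mk_surjective 𝒜 hf x
    rw [Away.map_mk] at hx
    have h1 := congrArg val hx
    rw [Away.val_mk, val_zero, Localization.mk_eq_mk', IsLocalization.mk'_eq_zero_iff] at h1
    obtain ⟨⟨_, j, rfl⟩, h1⟩ := h1
    have h2 : f ^ j * a = 0 := by
      refine hinj _ _ (SetLike.mul_mem_graded (SetLike.pow_mem_graded j hf) ha) ?_
      rw [map_mul, map_pow]
      exact h1
    apply val_injective
    rw [Away.val_mk, val_zero, Localization.mk_eq_mk', IsLocalization.mk'_eq_zero_iff]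
    exact ⟨⟨f ^ j, j, rfl⟩, h2⟩
  · intro y
    obtain ⟨m, b, hb, rfl⟩ := Away.mk_surjective ℬ (GradedFunLike.map_mem g hf) y
    obtain ⟨a, ha, hab⟩ := hsurj _ b hb
    refine ⟨Away.mk 𝒜 hf (m * d + m) a ?_, ?_⟩
    · convert ha using 2
      simp only [smul_eq_mul]
      ring
    · rw [Away.map_mk]
      apply val_injective
      rw [Away.val_mk, Away.val_mk, Localization.mk_eq_mk_iff, Localization.r_iff_exists]
      refine ⟨1, ?_⟩
      simp only [hab, OneMemClass.coe_one, one_mul, smul_eq_mul]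
      ring

theorem AlgebraicGeometry.isDominant_of_forall_specializes {U X : Scheme.{u}} (f : U ⟶ X)
    [IsOpenImmersion f] (η : X) (hη : ∀ x, η ⤳ x) (x : U) : IsDominant f := by
  have h1 : η ∈ f.opensRange := (hη (f x)).mem_open f.opensRange.2 ⟨x, rfl⟩
  refine ⟨fun y => ?_⟩
  have h2 : closure {η} ⊆ closure (Set.range f) := closure_mono (Set.singleton_subset_iff.mpr h1)
  exact h2 (hη y).mem_closure

/-- The generic point of projective space. -/
theorem exists_forall_specializes_projectiveSpace (k : Type u) [Field k] (n : ℕ) :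
    ∃ η : projectiveSpace k n, (∀ x, η ⤳ x) ∧
      ∀ f : MvPolynomial (Fin (n + 1)) k, f ≠ 0 → η ∈ Proj.basicOpen
        (MvPolynomial.homogeneousSubmodule (Fin (n + 1)) k) f := by
  let η : ProjectiveSpectrum (MvPolynomial.homogeneousSubmodule (Fin (n + 1)) k) :=
    { asHomogeneousIdeal := ⊥
      isPrime := Ideal.isPrime_bot
      not_irrelevant_le := fun h => MvPolynomial.X_ne_zero (R := k) (0 : Fin (n + 1))
        (h (HomogeneousIdeal.mem_irrelevant_of_mem _ one_pos (MvPolynomial.isHomogeneous_X k 0))) }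
  refine ⟨η, fun x => ?_, fun f hf h => hf h⟩
  refine specializes_iff_mem_closure.mpr ?_
  refine (ProjectiveSpectrum.le_iff_mem_closure _ η x).mp ?_
  exact (bot_le : ⊥ ≤ ProjectiveSpectrum.asHomogeneousIdeal (𝒜 := MvPolynomial.homogeneousSubmodule (Fin (n + 1)) k) x)

namespace AdaptedCoordinates

variable {k : Type u} [Field k] {N c n : ℕ} {F : Fin c → MvPolynomial (Fin (N + 1)) k}
  (hF : ∀ i, (F i).IsHomogeneous 2) (A : AdaptedCoordinates F n)

/-- The homogeneous coordinates in the homogeneous coordinate ring, a universal solution of the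
equations. -/
noncomputable def universalSolution (p : Fin (N + 1)) :
    MvPolynomial (Fin (N + 1)) k ⧸ (formsIdeal F hF).toIdeal :=
  Ideal.Quotient.mk (formsIdeal F hF).toIdeal (MvPolynomial.X p)

theorem aeval_universalSolution (f : MvPolynomial (Fin (N + 1)) k) :
    MvPolynomial.aeval (universalSolution hF) f = Ideal.Quotient.mk (formsIdeal F hF).toIdeal f := by
  have h := MvPolynomial.comp_aeval_apply (R := k) MvPolynomial.X
    (Ideal.Quotient.mkₐ k (formsIdeal F hF).toIdeal) f
  rw [MvPolynomial.aeval_X_left_apply] at h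
  exact h.symm

theorem aeval_universalSolution_eq_zero (i : Fin c) :
    MvPolynomial.aeval (universalSolution hF) (F i) = 0 := by
  rw [aeval_universalSolution, Ideal.Quotient.eq_zero_iff_mem]
  exact Ideal.subset_span ⟨i, rfl⟩

/-- The projection from the linear subspace `z = 0`, as a homomorphism from the homogeneous
coordinate ring of projective space to that of the intersection of quadrics. -/
noncomputable def projection :
    MvPolynomial (Fin (n + 1)) k →ₐ[k] MvPolynomial (Fin (N + 1)) k ⧸ (formsIdeal F hF).toIdeal :=
  MvPolynomial.aeval (A.zCoord (universalSolution hF))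

theorem projection_apply (f : MvPolynomial (Fin (n + 1)) k) : A.projection hF f =
    Ideal.Quotient.mk (formsIdeal F hF).toIdeal (MvPolynomial.aeval (A.zCoord MvPolynomial.X) f) := by
  have h := MvPolynomial.comp_aeval_apply (R := k) (A.zCoord MvPolynomial.X)
    (Ideal.Quotient.mkₐ k (formsIdeal F hF).toIdeal) f
  refine Eq.trans ?_ h.symm
  rw [projection]
  congr 2
  exact funext fun m => (A.map_zCoord (Ideal.Quotient.mkₐ k (formsIdeal F hF).toIdeal) MvPolynomial.X m).symm

theorem isHomogeneous_aeval_zCoord {m : ℕ} {f : MvPolynomial (Fin (n + 1)) k} (hf : f.IsHomogeneous m) :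
    (MvPolynomial.aeval (A.zCoord (MvPolynomial.X : _ → MvPolynomial (Fin (N + 1)) k)) f).IsHomogeneous m := by
  have h := hf.aeval (n := 1) (A.zCoord (MvPolynomial.X : _ → MvPolynomial (Fin (N + 1)) k)) fun i =>
    MvPolynomial.IsHomogeneous.sum _ _ _ fun p _ => MvPolynomial.isHomogeneous_C_mul_X _ _
  rwa [one_mul] at h

/-- The projection from the linear subspace `z = 0`, as a homomorphism of graded rings. -/
noncomputable def gradedProjection :
    MvPolynomial.homogeneousSubmodule (Fin (n + 1)) k →+*ᵍ quotientGrading (formsIdeal F hF) where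
  toRingHom := (A.projection hF).toRingHom
  map_mem {m f} hf := by
    change A.projection hF f ∈ _
    rw [projection_apply]
    exact mk_mem_quotientGrading _ (A.isHomogeneous_aeval_zCoord hf)

theorem gradedProjection_apply (f : MvPolynomial (Fin (n + 1)) k) :
    A.gradedProjection hF f = A.projection hF f :=
  rfl

theorem projection_aeval_parametrization {m : ℕ} {f : MvPolynomial (Fin (N + 1)) k} (hf : f.IsHomogeneous m) :
    A.projection hF (MvPolynomial.aeval A.parametrization f) =
      A.projection hF A.L.det ^ m * Ideal.Quotient.mk (formsIdeal F hF).toIdeal f := by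
  rw [MvPolynomial.comp_aeval_apply, ← aeval_universalSolution]
  have h := hf.aeval_smul (A.projection hF A.L.det) (universalSolution hF)
  rw [← h]
  congr 2
  funext p
  exact A.aeval_zCoord_parametrization _ (aeval_universalSolution_eq_zero hF) p

theorem evalCoordinateRing_projection {m : ℕ} {f : MvPolynomial (Fin (n + 1)) k} (hf : f.IsHomogeneous m) :
    evalCoordinateRing hF A.parametrization A.aeval_parametrization (A.projection hF f) =
      A.L.det ^ m * f := by
  rw [projection_apply, evalCoordinateRing_mk, MvPolynomial.comp_aeval_apply]
  have h := hf.aeval_smul A.L.det MvPolynomial.X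
  rw [MvPolynomial.aeval_X_left_apply] at h
  rw [← h]
  congr 2
  funext m
  rw [A.map_zCoord]
  simp only [MvPolynomial.aeval_X]
  exact congrFun (A.zCoord_point _ _) m

/-- On the open set where `det(L) z₀` does not vanish, the projection is an isomorphism, by Cramer's
rule. -/
theorem gradedProjection_map_bijective (hX : IsSmoothCompleteIntersection F hF) :
    Function.Bijective (HomogeneousLocalization.Away.map (A.gradedProjection hF)
      (A.L.det * MvPolynomial.X 0)) := by
  refine HomogeneousLocalization.Away.map_bijective _
    (A.isHomogeneous_det.mul (MvPolynomial.isHomogeneous_X k 0)) (fun m a ha h => ?_) ?_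
  · have h1 := A.evalCoordinateRing_projection hF ha
    rw [← gradedProjection_apply, h, map_zero] at h1
    exact (mul_eq_zero.mp h1.symm).resolve_left (pow_ne_zero m (A.det_ne_zero hX))
  · rintro m _ ⟨f, hf, rfl⟩
    have h1 := A.projection_aeval_parametrization hF hf
    have h2 : A.projection hF A.L.det ^ m * Ideal.Quotient.mk (formsIdeal F hF).toIdeal f ∈
        quotientGrading (formsIdeal F hF) (m * c + m) := by
      refine SetLike.mul_mem_graded ?_ (mk_mem_quotientGrading _ hf)
      exact SetLike.pow_mem_graded m (GradedFunLike.map_mem (A.gradedProjection hF) A.isHomogeneous_det)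
    -- a homogeneous component of the value at the parametrization
    let a : MvPolynomial (Fin (n + 1)) k := DirectSum.decompose (MvPolynomial.homogeneousSubmodule (Fin (n + 1)) k)
      (MvPolynomial.aeval A.parametrization f) (m * c + m)
    have ha : A.projection hF a =
        A.projection hF A.L.det ^ m * Ideal.Quotient.mk (formsIdeal F hF).toIdeal f := by
      rw [← gradedProjection_apply, GradedRingHom.map_directSumDecompose, gradedProjection_apply, h1,
        DirectSum.decompose_of_mem_same _ h2]
    refine ⟨MvPolynomial.X 0 ^ m * a, ?_, ?_⟩
    · convert SetLike.mul_mem_graded (SetLike.pow_mem_graded m (MvPolynomial.isHomogeneous_X k 0))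
        (SetLike.coe_mem (DirectSum.decompose (MvPolynomial.homogeneousSubmodule (Fin (n + 1)) k)
          (MvPolynomial.aeval A.parametrization f) (m * c + m))) using 2
      simp only [smul_eq_mul]
      ring
    · rw [gradedProjection_apply, gradedProjection_apply, map_mul, map_mul, ha, map_pow, mul_pow]
      change _ = _ * Ideal.Quotient.mk (formsIdeal F hF).toIdeal f
      ring

theorem map_comp_awayStructureMap (f : MvPolynomial (Fin (n + 1)) k) :
    (HomogeneousLocalization.Away.map (A.gradedProjection hF) f).comp (awayStructureMap _ f) =
      awayStructureMap _ (A.gradedProjection hF f) := by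
  ext r
  have h1 : A.gradedProjection hF (algebraMap k _ r) = algebraMap k _ r := (A.projection hF).commutes r
  change Localization.mk (A.gradedProjection hF (algebraMap k _ r)) ⟨A.gradedProjection hF 1, _⟩ =
    Localization.mk (algebraMap k _ r) 1
  simp only [h1, map_one]
  rfl

/-- A smooth intersection of quadrics with adapted coordinates is birational to projective space. -/
theorem birationalOver (A : AdaptedCoordinates F n)
    (hX : IsSmoothCompleteIntersection F hF) (hn : 0 < n) :
    Scheme.BirationalOver (intersectionToSpec F hF) (projectiveSpaceToSpec k n) := by
  have hh : A.L.det * MvPolynomial.X 0 ∈ MvPolynomial.homogeneousSubmodule (Fin (n + 1)) k (c + 1) :=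
    A.isHomogeneous_det.mul (MvPolynomial.isHomogeneous_X k 0)
  have hh0 : A.L.det * MvPolynomial.X 0 ≠ 0 :=
    mul_ne_zero (A.det_ne_zero hX) (MvPolynomial.X_ne_zero 0)
  have hg := GradedFunLike.map_mem (A.gradedProjection hF) hh
  obtain ⟨η, hη⟩ := A.exists_forall_specializes hX hn
  obtain ⟨η', hη', hη'0⟩ := exists_forall_specializes_projectiveSpace k n
  have hdom' : IsDominant (Proj.awayι _ _ hh c.succ_pos) := by
    have h1 := hη'0 _ hh0
    rw [← Proj.opensRange_awayι _ _ hh c.succ_pos] at h1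
    obtain ⟨x, -⟩ := h1
    exact isDominant_of_forall_specializes _ η' hη' x
  have hdom : IsDominant (Proj.awayι _ _ hg c.succ_pos) := by
    have h1 : solutionPoint hF A.parametrization (A.parametrization_ne_zero hX) A.aeval_parametrization ∈
        Proj.basicOpen (quotientGrading (formsIdeal F hF))
          (A.gradedProjection hF (A.L.det * MvPolynomial.X 0)) := by
      intro h
      rw [gradedProjection_apply, projection_apply] at h
      have h2 := (mk_mem_pointIdeal_solutionPoint hF _ _ _ (A.isHomogeneous_aeval_zCoord hh)).mp h
      have h3 := A.evalCoordinateRing_projection hF hh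
      rw [projection_apply, evalCoordinateRing_mk, h2] at h3
      exact mul_ne_zero (pow_ne_zero _ (A.det_ne_zero hX)) hh0 h3.symm
    rw [← Proj.opensRange_awayι _ _ hg c.succ_pos] at h1
    obtain ⟨x, -⟩ := h1
    exact isDominant_of_forall_specializes _ η hη x
  let e := RingEquiv.ofBijective _ (A.gradedProjection_map_bijective hF hX)
  have he : IsIso (Spec.map (CommRingCat.ofHom (HomogeneousLocalization.Away.map (A.gradedProjection hF)
      (A.L.det * MvPolynomial.X 0)))) :=
    inferInstanceAs (IsIso (Spec.map e.toCommRingCatIso.hom))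
  have h1 := Scheme.Hom.birationalOver (Proj.awayι _ _ hg c.succ_pos) (intersectionToSpec F hF) _
    (awayι_projStructureMap _ hg c.succ_pos)
  have h2 := Scheme.Hom.birationalOver
    (Spec.map (CommRingCat.ofHom (HomogeneousLocalization.Away.map (A.gradedProjection hF)
      (A.L.det * MvPolynomial.X 0))) ≫ Proj.awayι _ _ hh c.succ_pos) (projectiveSpaceToSpec k n) _ rfl
  rw [Category.assoc, awayι_projStructureMap, ← Spec.map_comp, ← CommRingCat.ofHom_comp,
    A.map_comp_awayStructureMap hF] at h2
  exact h1.symm.trans h2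

end AdaptedCoordinates

end Intersections

theorem corollary4p5 (k : Type u) [Field k] [CharZero k] (r : ℝ) (hr : 0 ≤ r) (hk : IsCr r k)
    (N c : ℕ) (hdim : c < N)
    (F : Fin c → MvPolynomial (Fin (N + 1)) k) (hF : ∀ i, (F i).IsHomogeneous 2)
    (hX : IsSmoothCompleteIntersection F hF)
    (hN : (N : ℝ) - (c : ℝ) ^ 2 + 2 > (2 : ℝ) ^ r * (c : ℝ)) :
    Scheme.BirationalOver (intersectionToSpec F hF) (projectiveSpaceToSpec k (N - c)) := by
  choose M hM hFM using fun i => (hF i).exists_isSymm_matrix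
  obtain ⟨v, hv, hiso⟩ := exists_linearIndependent_isotropic (m := N + 1) hr hk M hM c (by
    push_cast
    nlinarith)
  obtain ⟨A⟩ := exists_adaptedCoordinates (Nat.sub_add_cancel hdim.le) F M hM hFM v hv hiso
  exact A.birationalOver hF hX (Nat.sub_pos_of_lt hdim)
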